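/- Let $\hbar\in(0,1]$ and let $(q_j)_{j\ge 1}$ be a sequence of positive real numbers. For $n\in\mathbb N$ and Schwartz functions $g\in\mathcal S(\mathbb R^n)\setminus\{0\}$, let $$V_gf(x,\xi)=\langle f, \pi(x,\xi)g\rangle,\qquad \pi(x,\xi)g(y)=(2\pi\hbar)^{-n/2}e^{\frac{i}{\hbar}\xi\cdot y}g(y-x),\qquad x,\xi\in\mathbb R^n,$$ be the short-time Fourier transform of a tempered distribution $f\in\mathcal S'(\mathbb R^n)$, where $\langle f,h\rangle=f(\overline h)$, and let $$\|f\|_{M^{\infty,1}_{(g)}}=\int_{\mathbb R^n}\sup_{x\in\mathbb R^n}|V_gf(x,\xi)|\,d\xi\in[0,\infty].$$ Let $M^{\infty,1}(\mathbb R^n)$ be the set of all $f\in\mathcal S'(\mathbb R^n)$ such that $\|f\|_{M^{\infty,1}_{(g)}}<\infty$ for some $g\in\mathcal S(\mathbb R^n)\setminus\{0\}$. Every such $f$ is (given by integration against) a bounded continuous function, again denoted by $f$, which is Fresnel integrable; that is, the limit $$L_n(f)=\lim_{\varepsilon\downarrow0}(2\pi i\hbar)^{-n/2}\int_{\mathbb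 R^n}e^{\frac{i}{2\hbar}|x|^2}f(x)\varphi(\varepsilon x)\,dx$$ exists for all $\varphi\in\mathcal S(\mathbb R^n)$ with $\varphi(0)=1$ and does not depend on $\varphi$. Let $$g_n(x)=(2\pi\hbar)^{-n/2}\exp\Big(-\frac1{2\hbar}\sum_{j=1}^nq_jx_j^2\Big),\qquad \|L_n\|=\sup_{f\in M^{\infty,1}(\mathbb R^n)\setminus\{0\}}\frac{|L_n(f)|}{\|f\|_{M^{\infty,1}_{(g_n)}}}.$$ If $\sum_{j}q_j^2<\infty$, then $\sup_{n\in\mathbb N}\|L_n\|<\infty$. -/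

import Mathlib

open MeasureTheory Filter Topology
open scoped SchwartzMap ENNReal BoundedContinuousFunction

noncomputable section

namespace Fresnel

/-! ### Short-time Fourier transform and the Sjöstrand class -/

/-- The multiplier of the modulation operator `M_ξ`:
`y ↦ (2πħ)^{-d/2} exp((i/ħ) ξ · y)`. -/
def modulator {d : ℕ} (ħ : ℝ) (ξ y : EuclideanSpace ℝ (Fin d)) : ℂ :=
  (((2 * Real.pi * ħ) ^ (-(d : ℝ) / 2) : ℝ) : ℂ) *
    Complex.exp (Complex.I / (ħ : ℂ) * ((inner ℝ ξ y : ℝ) : ℂ))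

theorem hasTemperateGrowth_cexp_mul_I :
    (fun t : ℝ => Complex.exp (Complex.I * (t : ℂ))).HasTemperateGrowth := by
  have hder : ∀ n : ℕ, iteratedDeriv n (fun t : ℝ => Complex.exp (Complex.I * (t : ℂ)))
      = fun t : ℝ => Complex.I ^ n * Complex.exp (Complex.I * (t : ℂ)) := by
    intro n
    induction n with
    | zero => simp
    | succ n ih =>
      rw [iteratedDeriv_succ, ih]
      funext t
      have h1 : HasDerivAt (fun t : ℝ => Complex.I * (t : ℂ)) (Complex.I * 1) t :=
        (Complex.ofRealCLM.hasDerivAt (x := t)).const_mul Complex.I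
      have h2 := (h1.cexp).const_mul (Complex.I ^ n)
      rw [h2.deriv]
      ring
  refine ⟨?_, fun n => ⟨0, 1, fun x => ?_⟩⟩
  · exact Complex.contDiff_exp.comp (contDiff_const.mul Complex.ofRealCLM.contDiff)
  · rw [norm_iteratedFDeriv_eq_norm_iteratedDeriv, hder]
    simp [Complex.norm_exp]

theorem hasTemperateGrowth_modulator {d : ℕ} (ħ : ℝ) (ξ : EuclideanSpace ℝ (Fin d)) :
    (modulator ħ ξ).HasTemperateGrowth := by
  have h1 : (fun y : EuclideanSpace ℝ (Fin d) => ħ⁻¹ * inner ℝ ξ y).HasTemperateGrowth :=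
    (Function.HasTemperateGrowth.const ħ⁻¹).mul (Function.hasTemperateGrowth_inner_right ξ)
  have h2 := (Function.HasTemperateGrowth.const
    (((2 * Real.pi * ħ) ^ (-(d : ℝ) / 2) : ℝ) : ℂ)
    (E := EuclideanSpace ℝ (Fin d))).mul (hasTemperateGrowth_cexp_mul_I.comp h1)
  have he : modulator ħ ξ = (fun _ : EuclideanSpace ℝ (Fin d) =>
      (((2 * Real.pi * ħ) ^ (-(d : ℝ) / 2) : ℝ) : ℂ)) *
      ((fun t : ℝ => Complex.exp (Complex.I * (t : ℂ))) ∘ fun y => ħ⁻¹ * inner ℝ ξ y) := by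
    funext y
    simp only [modulator, Pi.mul_apply, Function.comp_apply]
    congr 2
    push_cast
    ring
  rw [he]
  exact h2

/-- The phase space shift `π(x,ξ) g = M_ξ T_x g` of a Schwartz function. -/
def phaseShift {d : ℕ} (ħ : ℝ) (x ξ : EuclideanSpace ℝ (Fin d))
    (g : 𝓢(EuclideanSpace ℝ (Fin d), ℂ)) : 𝓢(EuclideanSpace ℝ (Fin d), ℂ) :=
  SchwartzMap.smulLeftCLM ℂ (modulator ħ ξ) (SchwartzMap.compSubConstCLM ℂ x g)

theorem phaseShift_apply {d : ℕ} (ħ : ℝ) (x ξ : EuclideanSpace ℝ (Fin d))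
    (g : 𝓢(EuclideanSpace ℝ (Fin d), ℂ)) (y : EuclideanSpace ℝ (Fin d)) :
    phaseShift ħ x ξ g y =
      (((2 * Real.pi * ħ) ^ (-(d : ℝ) / 2) : ℝ) : ℂ) *
        Complex.exp (Complex.I / (ħ : ℂ) * ((inner ℝ ξ y : ℝ) : ℂ)) * g (y - x) := by
  simp [phaseShift, SchwartzMap.smulLeftCLM_apply_apply (hasTemperateGrowth_modulator ħ ξ),
    modulator]

/-- Pointwise complex conjugate of a Schwartz function. -/
def conjSchwartz {d : ℕ} (g : 𝓢(EuclideanSpace ℝ (Fin d), ℂ)) :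
    𝓢(EuclideanSpace ℝ (Fin d), ℂ) :=
  SchwartzMap.postcompCLM (𝕜 := ℝ) (Complex.conjCLE : ℂ →L[ℝ] ℂ) g

theorem conjSchwartz_apply {d : ℕ} (g : 𝓢(EuclideanSpace ℝ (Fin d), ℂ))
    (y : EuclideanSpace ℝ (Fin d)) :
    conjSchwartz g y = (starRingEnd ℂ) (g y) := by
  simp [conjSchwartz]

/-- The short-time Fourier transform `V_g T (x,ξ) = ⟨T, π(x,ξ) g⟩` of a tempered distribution,
where `⟨T, h⟩ = T (conj h)`. -/
def stft {d : ℕ} (ħ : ℝ) (g : 𝓢(EuclideanSpace ℝ (Fin d), ℂ))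
    (T : 𝓢'(EuclideanSpace ℝ (Fin d), ℂ)) (x ξ : EuclideanSpace ℝ (Fin d)) : ℂ :=
  T (conjSchwartz (phaseShift ħ x ξ g))

/-- The norm of `M^{∞,1}` with respect to the window `g`, with values in `[0,∞]`:
`∫ sup_x |V_g T (x,ξ)| dξ`. -/
def sjostrandNorm {d : ℕ} (ħ : ℝ) (g : 𝓢(EuclideanSpace ℝ (Fin d), ℂ))
    (T : 𝓢'(EuclideanSpace ℝ (Fin d), ℂ)) : ℝ≥0∞ :=
  ∫⁻ ξ : EuclideanSpace ℝ (Fin d), ⨆ x : EuclideanSpace ℝ (Fin d), ‖stft ħ g T x ξ‖ₑ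

/-- The Sjöstrand class `M^{∞,1}(ℝ^d)`: the tempered distributions whose norm is finite for some
nonzero Schwartz window. -/
def sjostrandClass (ħ : ℝ) (d : ℕ) : Set 𝓢'(EuclideanSpace ℝ (Fin d), ℂ) :=
  {T | ∃ g : 𝓢(EuclideanSpace ℝ (Fin d), ℂ), g ≠ 0 ∧ sjostrandNorm ħ g T < ⊤}

/-! ### Fresnel integrals -/

/-- The function `f` is Fresnel integrable with Fresnel integral `c`: for every Schwartz function
`φ` with `φ 0 = 1`, the regularized integrals
`(2πiħ)^{-d/2} ∫ exp(i|x|²/(2ħ)) f(x) φ(εx) dx` make sense and tend to `c` as `ε ↓ 0`. -/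
def HasFresnelIntegral {d : ℕ} (ħ : ℝ) (f : EuclideanSpace ℝ (Fin d) → ℂ) (c : ℂ) : Prop :=
  ∀ φ : 𝓢(EuclideanSpace ℝ (Fin d), ℂ), φ 0 = 1 →
    (∀ ε : ℝ, 0 < ε → Integrable (fun x : EuclideanSpace ℝ (Fin d) =>
      Complex.exp (Complex.I / (2 * (ħ : ℂ)) * ((‖x‖ ^ 2 : ℝ) : ℂ)) * f x * φ (ε • x))) ∧
    Tendsto (fun ε : ℝ =>
      (2 * (Real.pi : ℂ) * Complex.I * (ħ : ℂ)) ^ (-(d : ℂ) / 2) *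
        ∫ x : EuclideanSpace ℝ (Fin d),
          Complex.exp (Complex.I / (2 * (ħ : ℂ)) * ((‖x‖ ^ 2 : ℝ) : ℂ)) * f x * φ (ε • x))
      (𝓝[>] (0 : ℝ)) (𝓝 c)

open Classical in
/-- The Fresnel integral of a function (`0` if the function is not Fresnel integrable). -/
def fresnelIntegral {d : ℕ} (ħ : ℝ) (f : EuclideanSpace ℝ (Fin d) → ℂ) : ℂ :=
  if h : ∃ c : ℂ, HasFresnelIntegral ħ f c then h.choose else 0

/-- The tempered distribution `T` is given by integration against the bounded continuous
function `f`. -/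
def IsRepresentedBy {d : ℕ} (T : 𝓢'(EuclideanSpace ℝ (Fin d), ℂ))
    (f : EuclideanSpace ℝ (Fin d) →ᵇ ℂ) : Prop :=
  ∀ φ : 𝓢(EuclideanSpace ℝ (Fin d), ℂ), T φ = ∫ x : EuclideanSpace ℝ (Fin d), f x * φ x

open Classical in
/-- The (unique) bounded continuous function that represents `T` (`0` if there is none). -/
def representative {d : ℕ} (T : 𝓢'(EuclideanSpace ℝ (Fin d), ℂ)) :
    EuclideanSpace ℝ (Fin d) →ᵇ ℂ :=
  if h : ∃ f : EuclideanSpace ℝ (Fin d) →ᵇ ℂ, IsRepresentedBy T f then h.choose else 0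

/-- The functional `L_d`: the Fresnel integral of an element of `M^{∞,1}(ℝ^d)`, which is identified
with a bounded continuous function. -/
def fresnelFunctional {d : ℕ} (ħ : ℝ) (T : 𝓢'(EuclideanSpace ℝ (Fin d), ℂ)) : ℂ :=
  fresnelIntegral ħ (representative T)

/-- The operator norm (in `[0,∞]`) of the Fresnel functional on `M^{∞,1}(ℝ^d)`, normed with the
window `g`. -/
def fresnelOpNorm {d : ℕ} (ħ : ℝ) (g : 𝓢(EuclideanSpace ℝ (Fin d), ℂ)) : ℝ≥0∞ :=
  ⨆ T ∈ {T : 𝓢'(EuclideanSpace ℝ (Fin d), ℂ) | T ∈ sjostrandClass ħ d ∧ T ≠ 0},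
    ‖fresnelFunctional ħ T‖ₑ / sjostrandNorm ħ g T

/-! ### Gaussian windows -/

theorem exists_bound_iteratedFDeriv_exp_quadratic {n : ℕ} (b : Fin n → ℝ) (hb : ∀ j, 0 < b j)
    (k l : ℕ) : ∃ C : ℝ, ∀ x : EuclideanSpace ℝ (Fin n),
      ‖x‖ ^ k * ‖iteratedFDeriv ℝ l
        (fun x : EuclideanSpace ℝ (Fin n) => Real.exp (-∑ j, b j * x j ^ 2)) x‖ ≤ C := by
  obtain ⟨a, ha, hab⟩ : ∃ a : ℝ, 0 < a ∧ ∀ j, a ≤ b j := by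
    rcases isEmpty_or_nonempty (Fin n) with h | h
    · exact ⟨1, one_pos, fun j => h.elim j⟩
    · obtain ⟨i, hi⟩ := Finite.exists_min b
      exact ⟨b i, hb i, hi⟩
  have hf : (fun x : EuclideanSpace ℝ (Fin n) => -∑ j, b j * x j ^ 2).HasTemperateGrowth := by
    have h1 : ∀ j : Fin n, (fun x : EuclideanSpace ℝ (Fin n) => x j).HasTemperateGrowth :=
      fun j => (EuclideanSpace.proj j : EuclideanSpace ℝ (Fin n) →L[ℝ] ℝ).hasTemperateGrowth
    have h2 : (fun x : EuclideanSpace ℝ (Fin n) => ∑ j, b j * x j ^ 2).HasTemperateGrowth :=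
      Function.HasTemperateGrowth.sum fun j _ =>
        (Function.HasTemperateGrowth.const (b j)).mul ((h1 j).pow 2)
    exact h2.neg
  obtain ⟨m, D, hD, hbd⟩ := hf.norm_iteratedFDeriv_le_uniform l
  have hquad : ∀ x : EuclideanSpace ℝ (Fin n), -∑ j, b j * x j ^ 2 ≤ -(a * ‖x‖ ^ 2) := by
    intro x
    rw [EuclideanSpace.real_norm_sq_eq, Finset.mul_sum, neg_le_neg_iff]
    exact Finset.sum_le_sum fun j _ => mul_le_mul_of_nonneg_right (hab j) (sq_nonneg _)
  refine ⟨l.factorial * (1 + D) ^ l * ((k + m * l).factorial * Real.exp (1 + 1 / (4 * a))),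
    fun x => ?_⟩
  have hexp : ∀ i, i ≤ l → ‖iteratedFDeriv ℝ i Real.exp (-∑ j, b j * x j ^ 2)‖
      ≤ Real.exp (-∑ j, b j * x j ^ 2) := by
    intro i _
    rw [norm_iteratedFDeriv_eq_norm_iteratedDeriv, iteratedDeriv_eq_iterate, Real.iter_deriv_exp]
    simp
  have hin : ∀ i, 1 ≤ i → i ≤ l →
      ‖iteratedFDeriv ℝ i (fun x : EuclideanSpace ℝ (Fin n) => -∑ j, b j * x j ^ 2) x‖
        ≤ ((1 + D) * (1 + ‖x‖) ^ m) ^ i := by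
    intro i hi hil
    calc _ ≤ D * (1 + ‖x‖) ^ m := hbd i hil x
      _ ≤ (1 + D) * (1 + ‖x‖) ^ m := by gcongr; simp
      _ ≤ _ := le_self_pow₀ (one_le_mul_of_one_le_of_one_le (by simp [hD])
        (one_le_pow₀ (by simp))) (by omega)
  have key := norm_iteratedFDeriv_comp_le (N := ((⊤ : ℕ∞) : WithTop ℕ∞))
    Real.contDiff_exp hf.1 (mod_cast le_top) x hexp hin
  have hr : (1 + ‖x‖) ^ (k + m * l) ≤ (k + m * l).factorial * Real.exp (1 + ‖x‖) := by
    have := Real.pow_div_factorial_le_exp (1 + ‖x‖) (by positivity) (k + m * l)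
    rw [div_le_iff₀ (by positivity)] at this
    exact this.trans_eq (mul_comm _ _)
  have hsq : 1 + ‖x‖ - a * ‖x‖ ^ 2 ≤ 1 + 1 / (4 * a) := by
    have : 1 / (4 * a) - ‖x‖ + a * ‖x‖ ^ 2 = (2 * a * ‖x‖ - 1) ^ 2 / (4 * a) := by
      field_simp
      ring
    have h0 : 0 ≤ (2 * a * ‖x‖ - 1) ^ 2 / (4 * a) := by positivity
    linarith
  calc _ ≤ (1 + ‖x‖) ^ k * (l.factorial * Real.exp (-∑ j, b j * x j ^ 2) *
        ((1 + D) * (1 + ‖x‖) ^ m) ^ l) := by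
        gcongr
        · simp
        · exact key
    _ = l.factorial * (1 + D) ^ l *
        ((1 + ‖x‖) ^ (k + m * l) * Real.exp (-∑ j, b j * x j ^ 2)) := by
        rw [mul_pow, ← pow_mul, pow_add]; ring
    _ ≤ l.factorial * (1 + D) ^ l * (((k + m * l).factorial * Real.exp (1 + ‖x‖)) *
        Real.exp (-(a * ‖x‖ ^ 2))) := by
        gcongr
        exact neg_le_neg_iff.mp (hquad x)
    _ = l.factorial * (1 + D) ^ l * ((k + m * l).factorial *
        Real.exp (1 + ‖x‖ - a * ‖x‖ ^ 2)) := by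
        rw [mul_assoc _ (Real.exp _), ← Real.exp_add]; ring_nf
    _ ≤ _ := by gcongr

/-- The real Gaussian `x ↦ exp(-∑ b_j x_j²)` with `b_j > 0`, as a Schwartz function. -/
def realGaussian {n : ℕ} (b : Fin n → ℝ) (hb : ∀ j, 0 < b j) :
    𝓢(EuclideanSpace ℝ (Fin n), ℝ) where
  toFun x := Real.exp (-∑ j, b j * x j ^ 2)
  smooth' := by fun_prop
  decay' k l := exists_bound_iteratedFDeriv_exp_quadratic b hb k l

/-- The window `g_n(x) = (2πħ)^{-n/2} exp(-⟨x, Q_n x⟩/(2ħ))`, where `Q_n` is the diagonal matrix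
whose entries are the first `n` terms of `q`. -/
def gaussianWindow (ħ : ℝ) (hħ : 0 < ħ) (q : ℕ → ℝ) (hq : ∀ j, 0 < q j) (n : ℕ) :
    𝓢(EuclideanSpace ℝ (Fin n), ℂ) :=
  ((2 * Real.pi * ħ) ^ (-(n : ℝ) / 2) : ℝ) •
    SchwartzMap.postcompCLM (𝕜 := ℝ) Complex.ofRealCLM
      (realGaussian (fun j : Fin n => q j / (2 * ħ)) fun j => div_pos (hq j) (by positivity))

theorem gaussianWindow_apply (ħ : ℝ) (hħ : 0 < ħ) (q : ℕ → ℝ) (hq : ∀ j, 0 < q j) (n : ℕ)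
    (x : EuclideanSpace ℝ (Fin n)) :
    gaussianWindow ħ hħ q hq n x =
      (((2 * Real.pi * ħ) ^ (-(n : ℝ) / 2) *
        Real.exp (-(1 / (2 * ħ)) * ∑ j : Fin n, q j * x j ^ 2) : ℝ) : ℂ) := by
  have h : -(1 / (2 * ħ)) * ∑ j : Fin n, q j * x j ^ 2 = -∑ j : Fin n, q j / (2 * ħ) * x j ^ 2 := by
    rw [neg_mul, Finset.mul_sum]
    congr 1
    exact Finset.sum_congr rfl fun j _ => by ring
  rw [h, Complex.ofReal_mul, ← Complex.real_smul]
  rfl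

end Fresnel

end

/-! With `a = (2πħ)⁻¹` the Fresnel phase is `chirp a`, and everything rests on
`chirp_mul_chirp_neg_sub`: multiplying it by the conjugate chirp centred at x leaves, as a function
of y, a linear phase of frequency `a • x`. The regularized integral is therefore averaged over the
translates of `chirp (-a) * Γ * h`, where h is the conjugated window and Γ an auxiliary Schwartz
function. Integrating in x first only produces the constant κ = ∫ `chirp (-a)` Γ h. Integrating in y
first, Parseval gives a pairing of the short-time Fourier transform of f at w with a smoothed value
of 𝓕⁻Γ at w + ax (`fresnel_regularized_eq`). Dominated convergence removes the cutoff, and bounding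
the transform by its supremum over positions gives |κ| |L_n(f)| ≤ ‖𝓕⁻Γ‖_{L¹} ‖f‖, all powers of 2πħ
cancelling (`exists_tendsto_fresnel`, `exists_hasFresnelIntegral`).

For the window g_n take Γ(x) = exp(-∑ q_j x_j²/(2ħ)). Its Fourier transform is positive, so
‖𝓕⁻Γ‖_{L¹} = Γ(0) = 1, while κ is a Gaussian integral with |κ| = ∏ (1 + 4q_j²)^{-1/4} ≥ exp(-∑
q_j²). Hence ‖L_n‖ ≤ exp(∑ q_j²), the sum running over the first n terms.

That elements of the class are functions is proved by localization: T multiplied by a translate of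
the window is the inverse Fourier transform of an integrable function, and these bounded continuous
pieces are compatible, so they glue (`exists_boundedContinuous_representation`). This uses that T
commutes with integrals of Schwartz functions (`map_integral_schwartz`). -/

noncomputable section

namespace Fresnel

open scoped FourierTransform

/-! ### Interchanging a tempered distribution with an integral of Schwartz functions -/

section Interchange

variable {V : Type*} [NormedAddCommGroup V] [NormedSpace ℝ V]

theorem iteratedFDeriv_schwartz_sub (f g : 𝓢(V, ℂ)) (l : ℕ) (x : V) :
    iteratedFDeriv ℝ l (f - g : 𝓢(V, ℂ)) x
      = iteratedFDeriv ℝ l f x - iteratedFDeriv ℝ l g x := by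
  have : ((f - g : 𝓢(V, ℂ)) : V → ℂ) = (f : V → ℂ) - g := by ext; simp
  rw [this, iteratedFDeriv_sub_apply ((f.smooth l).contDiffAt) ((g.smooth l).contDiffAt)]

/-- Uniformly Cauchy derivatives converge uniformly, and their limit is the derivative of the
pointwise limit, which is the zero function. -/
theorem tendsto_fderiv_zero_of_uniformCauchy {W : Type*} [NormedAddCommGroup W] [NormedSpace ℝ W]
    [CompleteSpace W] {f : ℕ → V → W} {F' : ℕ → V → V →L[ℝ] W}
    (hder : ∀ n x, HasFDerivAt (f n) (F' n x) x) (h0 : ∀ x, Tendsto (fun n => f n x) atTop (𝓝 0))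
    (hc : ∀ ε > 0, ∃ M, ∀ m ≥ M, ∀ n ≥ M, ∀ x, ‖F' m x - F' n x‖ < ε) (x : V) :
    Tendsto (fun n => ‖F' n x‖) atTop (𝓝 0) := by
  have hcau : UniformCauchySeqOn F' atTop Set.univ := by
    rw [Metric.uniformCauchySeqOn_iff]
    intro ε hε
    obtain ⟨M, hM⟩ := hc ε hε
    exact ⟨M, fun m hm n hn x _ => by rw [dist_eq_norm]; exact hM m hm n hn x⟩
  have hlim : ∀ x, ∃ G, Tendsto (fun n => F' n x) atTop (𝓝 G) := fun x =>
    cauchySeq_tendsto_of_complete (hcau.cauchySeq (Set.mem_univ x))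
  choose G hG using hlim
  have hunif : TendstoUniformly F' G atTop :=
    tendstoUniformlyOn_univ.1 (hcau.tendstoUniformlyOn_of_tendsto fun x _ => hG x)
  have hz := hasFDerivAt_of_tendstoUniformly hunif hder h0 x
  have hGx : G x = 0 := hz.unique (hasFDerivAt_const _ _)
  rw [← tendsto_zero_iff_norm_tendsto_zero, ← hGx]
  exact hG x

/-- Induction on the order: the unweighted seminorm of order l + 1 makes the derivatives of the l-th
derivatives uniformly Cauchy. -/
theorem tendsto_iteratedFDeriv_zero_of_cauchy {φ : ℕ → 𝓢(V, ℂ)} {N : ℕ}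
    (hc : ∀ l ≤ N, ∀ ε > 0, ∃ M, ∀ m ≥ M, ∀ n ≥ M, SchwartzMap.seminorm ℂ 0 l (φ m - φ n) < ε)
    (h0 : ∀ x, Tendsto (fun n => φ n x) atTop (𝓝 0)) :
    ∀ l ≤ N, ∀ x, Tendsto (fun n => iteratedFDeriv ℝ l (φ n) x) atTop (𝓝 0) := by
  intro l
  induction l with
  | zero =>
    intro _ x
    rw [tendsto_zero_iff_norm_tendsto_zero]
    simpa using (h0 x).norm
  | succ l ih =>
    intro hl x
    have ih := ih (by omega)
    set F' : ℕ → V → (V →L[ℝ] (V [×l]→L[ℝ] ℂ)) := fun n => fderiv ℝ (iteratedFDeriv ℝ l (φ n))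
    have hder : ∀ n x, HasFDerivAt (iteratedFDeriv ℝ l (φ n)) (F' n x) x := fun n x =>
      (((φ n).smooth (l + 1)).differentiable_iteratedFDeriv (by exact_mod_cast Nat.lt_succ_self l)
        x).hasFDerivAt
    have hdiff : ∀ m n x, ‖F' m x - F' n x‖ ≤ SchwartzMap.seminorm ℂ 0 (l + 1) (φ m - φ n) := by
      intro m n x
      have h1 : F' m x - F' n x = fderiv ℝ (iteratedFDeriv ℝ l (φ m - φ n : 𝓢(V, ℂ))) x := by
        have : iteratedFDeriv ℝ l (φ m - φ n : 𝓢(V, ℂ))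
            = fun y => iteratedFDeriv ℝ l (φ m) y - iteratedFDeriv ℝ l (φ n) y :=
          funext fun y => iteratedFDeriv_schwartz_sub _ _ _ _
        rw [this]
        exact ((hder m x).sub (hder n x)).fderiv.symm
      rw [h1, norm_fderiv_iteratedFDeriv]
      exact SchwartzMap.norm_iteratedFDeriv_le_seminorm ℂ _ _ _
    have hz := tendsto_fderiv_zero_of_uniformCauchy hder ih (fun ε hε => by
      obtain ⟨M, hM⟩ := hc (l + 1) hl ε hε
      exact ⟨M, fun m hm n hn x => (hdiff m n x).trans_lt (hM m hm n hn)⟩) x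
    rw [tendsto_zero_iff_norm_tendsto_zero]
    simpa [F', norm_fderiv_iteratedFDeriv] using hz

/-- The Schwartz seminorm controlling all weights and derivatives up to order `N`. -/
def supSeminorm (V : Type*) [NormedAddCommGroup V] [NormedSpace ℝ V] (N : ℕ × ℕ) :
    Seminorm ℂ 𝓢(V, ℂ) :=
  (Finset.Iic N).sup (schwartzSeminormFamily ℂ V ℂ)

theorem continuous_supSeminorm (N : ℕ × ℕ) : Continuous (supSeminorm V N) := by
  refine Seminorm.continuous_of_continuousAt_zero ?_
  have h : ∀ s : Finset (ℕ × ℕ),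
      Continuous (s.sup (schwartzSeminormFamily ℂ V ℂ) : Seminorm ℂ 𝓢(V, ℂ)) := by
    intro s
    induction s using Finset.induction_on with
    | empty => exact continuous_const (y := (0 : ℝ))
    | insert i s _ ih =>
      rw [Finset.sup_insert]
      exact ((schwartz_withSeminorms ℂ V ℂ).continuous_seminorm i).sup ih
  exact (h _).continuousAt

theorem seminorm_le_supSeminorm {N : ℕ × ℕ} {k l : ℕ} (hk : k ≤ N.1) (hl : l ≤ N.2)
    (f : 𝓢(V, ℂ)) : SchwartzMap.seminorm ℂ k l f ≤ supSeminorm V N f :=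
  (Finset.le_sup (f := schwartzSeminormFamily ℂ V ℂ)
    (b := (k, l)) (Finset.mem_Iic.2 (Prod.mk_le_mk.2 ⟨hk, hl⟩)) :
      schwartzSeminormFamily ℂ V ℂ (k, l) ≤ supSeminorm V N) f

theorem supSeminorm_le {N : ℕ × ℕ} {f : 𝓢(V, ℂ)} {a : ℝ} (ha : 0 ≤ a)
    (h : ∀ k ≤ N.1, ∀ l ≤ N.2, SchwartzMap.seminorm ℂ k l f ≤ a) : supSeminorm V N f ≤ a :=
  Seminorm.finset_sup_apply_le ha fun i hi =>
    h i.1 (Finset.mem_Iic.1 hi).1 i.2 (Finset.mem_Iic.1 hi).2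

/-- The seminorms `supSeminorm` are directed, so one of them suffices where a finite family would
appear. -/
theorem exists_le_supSeminorm (q : Seminorm ℂ 𝓢(V, ℂ)) (hq : Continuous q) :
    ∃ (N : ℕ × ℕ) (C : ℝ), 0 ≤ C ∧ ∀ f, q f ≤ C * supSeminorm V N f := by
  obtain ⟨s, C, -, h⟩ := Seminorm.bound_of_continuous (schwartz_withSeminorms ℂ V ℂ) q hq
  refine ⟨s.sup id, C, C.2, fun f => (h f).trans ?_⟩
  have : s.sup (schwartzSeminormFamily ℂ V ℂ) ≤ supSeminorm V (s.sup id) :=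
    Finset.sup_mono fun i hi => Finset.mem_Iic.2 (Finset.le_sup (f := id) hi)
  exact mul_le_mul_of_nonneg_left (this f) C.2

/-- This is what makes point evaluations separate the points of the completion for a single
seminorm, so that an identity there can be checked pointwise. -/
theorem tendsto_supSeminorm_zero_of_cauchy {φ : ℕ → 𝓢(V, ℂ)} {N : ℕ × ℕ}
    (hc : ∀ ε > 0, ∃ M, ∀ m ≥ M, ∀ n ≥ M, supSeminorm V N (φ m - φ n) < ε)
    (h0 : ∀ x, Tendsto (fun n => φ n x) atTop (𝓝 0)) :
    Tendsto (fun n => supSeminorm V N (φ n)) atTop (𝓝 0) := by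
  have hd := tendsto_iteratedFDeriv_zero_of_cauchy (N := N.2) (fun l hl ε hε => by
    obtain ⟨M, hM⟩ := hc ε hε
    exact ⟨M, fun m hm n hn =>
      (seminorm_le_supSeminorm (Nat.zero_le _) hl _).trans_lt (hM m hm n hn)⟩) h0
  rw [Metric.tendsto_atTop]
  intro ε hε
  obtain ⟨M, hM⟩ := hc (ε / 2) (half_pos hε)
  refine ⟨M, fun n hn => ?_⟩
  rw [Real.dist_0_eq_abs, abs_of_nonneg (apply_nonneg _ _)]
  refine lt_of_le_of_lt (supSeminorm_le (half_pos hε).le fun k hk l hl => ?_) (half_lt_self hε)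
  refine SchwartzMap.seminorm_le_bound ℂ k l _ (half_pos hε).le fun x => ?_
  -- Let m → ∞ in the Cauchy estimate at a fixed point x, where the derivatives of φ m vanish in the
  -- limit.
  have hlim : Tendsto (fun m => ‖x‖ ^ k *
      ‖iteratedFDeriv ℝ l (φ n) x - iteratedFDeriv ℝ l (φ m) x‖) atTop
      (𝓝 (‖x‖ ^ k * ‖iteratedFDeriv ℝ l (φ n) x - 0‖)) :=
    ((tendsto_const_nhds.sub (hd l hl x)).norm).const_mul _
  rw [sub_zero] at hlim
  refine le_of_tendsto hlim (eventually_atTop.2 ⟨M, fun m hm => ?_⟩)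
  rw [← iteratedFDeriv_schwartz_sub]
  exact (SchwartzMap.le_seminorm ℂ k l (φ n - φ m) x).trans
    ((seminorm_le_supSeminorm hk hl _).trans (hM n hn m hm).le)

/-- The Schwartz space as a seminormed space, with one of its seminorms. -/
def SeminormedSchwartz (V : Type*) [NormedAddCommGroup V] [NormedSpace ℝ V] (_N : ℕ × ℕ) : Type _ :=
  𝓢(V, ℂ)

namespace SeminormedSchwartz

variable {N : ℕ × ℕ}

instance : AddCommGroup (SeminormedSchwartz V N) := inferInstanceAs (AddCommGroup 𝓢(V, ℂ))

instance : Module ℂ (SeminormedSchwartz V N) := inferInstanceAs (Module ℂ 𝓢(V, ℂ))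

instance : SeminormedAddCommGroup (SeminormedSchwartz V N) :=
  AddGroupSeminorm.toSeminormedAddCommGroup (E := SeminormedSchwartz V N)
    (supSeminorm V N).toAddGroupSeminorm

/-- The identity map into the seminormed space. -/
def of (N : ℕ × ℕ) : 𝓢(V, ℂ) ≃ₗ[ℂ] SeminormedSchwartz V N := LinearEquiv.refl ℂ _

theorem norm_of (f : 𝓢(V, ℂ)) : ‖of N f‖ = supSeminorm V N f := rfl

instance : NormedSpace ℂ (SeminormedSchwartz V N) where
  norm_smul_le c f := (map_smul_eq_mul (supSeminorm V N) c ((of N).symm f)).le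

theorem continuous_of : Continuous (of N : 𝓢(V, ℂ) → SeminormedSchwartz V N) := by
  refine continuous_of_continuousAt_zero (of (V := V) N).toLinearMap ?_
  rw [ContinuousAt, map_zero, tendsto_zero_iff_norm_tendsto_zero]
  have := (continuous_supSeminorm (V := V) N).tendsto 0
  rw [map_zero] at this
  exact this

/-- The extension to the completion of a functional that is bounded for the seminorm. -/
theorem exists_extension (L : 𝓢(V, ℂ) →ₗ[ℂ] ℂ) (C : ℝ) (hL : ∀ f, ‖L f‖ ≤ C * supSeminorm V N f) :
    ∃ L' : UniformSpace.Completion (SeminormedSchwartz V N) →L[ℂ] ℂ,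
      ∀ f, L' (of N f : SeminormedSchwartz V N) = L f := by
  let L₁ : SeminormedSchwartz V N →L[ℂ] ℂ :=
    LinearMap.mkContinuous (L ∘ₗ (of (V := V) N).symm.toLinearMap) C
      fun f => hL ((of N).symm f)
  refine ⟨L₁.extend UniformSpace.Completion.toComplL, fun f => ?_⟩
  exact L₁.extend_eq (e := UniformSpace.Completion.toComplL)
    (UniformSpace.Completion.denseRange_coe)
    (UniformSpace.Completion.isUniformInducing_coe _) (of N f)

end SeminormedSchwartz

open SeminormedSchwartz in
/-- A tempered distribution commutes with an absolutely convergent, continuous integral of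
Schwartz functions. -/
theorem map_integral_schwartz {α : Type*} [TopologicalSpace α] [SecondCountableTopology α]
    [MeasurableSpace α] [OpensMeasurableSpace α] {μ : Measure α}
    (T : 𝓢(V, ℂ) →L[ℂ] ℂ) (Φ : α → 𝓢(V, ℂ)) (hΦ : Continuous Φ)
    (hint : ∀ N, Integrable (fun a => supSeminorm V N (Φ a)) μ) (Ψ : 𝓢(V, ℂ))
    (hΨ : ∀ y, Ψ y = ∫ a, Φ a y ∂μ) :
    T Ψ = ∫ a, T (Φ a) ∂μ := by
  -- T is bounded by one seminorm, so it factors through a Banach space, where the Bochner integral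
  -- is available.
  obtain ⟨N, C, -, hC⟩ := exists_le_supSeminorm ((normSeminorm ℂ ℂ).comp T.toLinearMap)
    (continuous_norm.comp T.continuous)
  obtain ⟨T', hT'⟩ := exists_extension (N := N) T.toLinearMap C hC
  have hev : ∀ y : V, ∃ L' : UniformSpace.Completion (SeminormedSchwartz V N) →L[ℂ] ℂ,
      ∀ f : 𝓢(V, ℂ), L' (of N f : SeminormedSchwartz V N) = f y := fun y => by
    refine exists_extension (N := N)
      ⟨⟨fun f : 𝓢(V, ℂ) => f y, fun f g => by simp⟩, fun c f => by simp⟩ 1 fun f => ?_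
    rw [one_mul]
    exact (SchwartzMap.norm_le_seminorm ℂ f y).trans
      (seminorm_le_supSeminorm (Nat.zero_le _) (Nat.zero_le _) f)
  choose ev hev using hev
  set ι : 𝓢(V, ℂ) → UniformSpace.Completion (SeminormedSchwartz V N) :=
    fun f => (of N f : SeminormedSchwartz V N)
  have hι : Continuous ι := (UniformSpace.Completion.continuous_coe _).comp continuous_of
  have hιn : ∀ f, ‖ι f‖ = supSeminorm V N f := fun f =>
    (UniformSpace.Completion.norm_coe _).trans (norm_of f)
  have hιsub : ∀ f g, ι f - ι g = ι (f - g) := fun f g => by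
    simp only [ι, map_sub, UniformSpace.Completion.coe_sub]
  have hI : Integrable (fun a => ι (Φ a)) μ :=
    (hint N).mono' (hι.comp hΦ).aestronglyMeasurable (ae_of_all _ fun a => (hιn _).le)
  -- The difference w of the two sides is killed by every evaluation. A sequence of Schwartz
  -- functions tending to w is then Cauchy and tends pointwise to 0, hence tends to 0 in the
  -- seminorm.
  have hw : ∫ a, ι (Φ a) ∂μ = ι Ψ := by
    rw [← sub_eq_zero]
    set w := ∫ a, ι (Φ a) ∂μ - ι Ψ with hwdef
    have hevw : ∀ y, ev y w = 0 := fun y => by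
      rw [hwdef, map_sub, ← (ev y).integral_comp_comm hI, hev, hΨ, sub_eq_zero]
      exact integral_congr_ae (ae_of_all _ fun a => hev y _)
    have hdense : w ∈ closure (Set.range ((↑) : SeminormedSchwartz V N → _)) :=
      UniformSpace.Completion.denseRange_coe w
    obtain ⟨u, hu, hulim⟩ := mem_closure_iff_seq_limit.1 hdense
    choose φ' hφ' using hu
    set φ : ℕ → 𝓢(V, ℂ) := fun n => (of N).symm (φ' n)
    have hφ : ∀ n, ι (φ n) = u n := fun n => by simp only [ι, φ, LinearEquiv.apply_symm_apply, hφ']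
    have hlim : Tendsto (fun n => ι (φ n)) atTop (𝓝 w) := by simpa only [hφ] using hulim
    have hz : Tendsto (fun n => supSeminorm V N (φ n)) atTop (𝓝 0) := by
      refine tendsto_supSeminorm_zero_of_cauchy (fun ε hε => ?_) fun y => ?_
      · obtain ⟨M, hM⟩ := Metric.cauchySeq_iff.1 hlim.cauchySeq ε hε
        refine ⟨M, fun m hm n hn => ?_⟩
        have := hM m hm n hn
        rwa [dist_eq_norm, hιsub, hιn] at this
      · have := ((ev y).continuous.tendsto w).comp hlim
        rw [hevw] at this
        exact this.congr fun n => hev y _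
    simp only [← hιn] at hz
    exact tendsto_nhds_unique hlim (tendsto_zero_iff_norm_tendsto_zero.2 hz)
  calc T Ψ = T' (ι Ψ) := (hT' Ψ).symm
    _ = ∫ a, T' (ι (Φ a)) ∂μ := by rw [← hw, T'.integral_comp_comm hI]
    _ = _ := integral_congr_ae (ae_of_all _ fun a => hT' _)

end Interchange

/-! ### Translations of Schwartz functions -/

section Translation

variable {V : Type*} [NormedAddCommGroup V] [NormedSpace ℝ V]

theorem iteratedFDeriv_compSubConst (a : V) (f : 𝓢(V, ℂ)) (l : ℕ) (x : V) :
    iteratedFDeriv ℝ l (SchwartzMap.compSubConstCLM ℂ a f) x = iteratedFDeriv ℝ l f (x - a) := by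
  have : (SchwartzMap.compSubConstCLM ℂ a f : V → ℂ) = fun z => f (z - a) := by ext; simp
  rw [this, iteratedFDeriv_comp_sub]

theorem norm_pow_le_of_sub {V : Type*} [NormedAddCommGroup V] (a x : V) (k : ℕ) : ‖x‖ ^ k ≤ 2 ^ k * (‖x - a‖ ^ k + ‖a‖ ^ k) := by
  calc ‖x‖ ^ k ≤ (‖x - a‖ + ‖a‖) ^ k := by
        gcongr
        simpa using norm_add_le (x - a) a
    _ ≤ 2 ^ (k - 1) * (‖x - a‖ ^ k + ‖a‖ ^ k) := add_pow_le (norm_nonneg _) (norm_nonneg _) k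
    _ ≤ _ := by
        gcongr
        · norm_num
        · omega

theorem seminorm_compSubConst_le (k l : ℕ) (a : V) (f : 𝓢(V, ℂ)) :
    SchwartzMap.seminorm ℂ k l (SchwartzMap.compSubConstCLM ℂ a f)
      ≤ 2 ^ k * (SchwartzMap.seminorm ℂ k l f + ‖a‖ ^ k * SchwartzMap.seminorm ℂ 0 l f) := by
  refine SchwartzMap.seminorm_le_bound ℂ k l _ (by positivity) fun x => ?_
  rw [iteratedFDeriv_compSubConst]
  calc _ ≤ 2 ^ k * (‖x - a‖ ^ k + ‖a‖ ^ k) * ‖iteratedFDeriv ℝ l f (x - a)‖ := by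
        gcongr
        exact norm_pow_le_of_sub a x k
    _ = 2 ^ k * (‖x - a‖ ^ k * ‖iteratedFDeriv ℝ l f (x - a)‖
          + ‖a‖ ^ k * ‖iteratedFDeriv ℝ l f (x - a)‖) := by ring
    _ ≤ _ := by
        gcongr
        · exact SchwartzMap.le_seminorm ℂ k l f _
        · exact SchwartzMap.norm_iteratedFDeriv_le_seminorm ℂ f l _

theorem exists_supSeminorm_compSubConst_le (N : ℕ × ℕ) (f : 𝓢(V, ℂ)) :
    ∃ (C : ℝ) (m : ℕ), 0 ≤ C ∧
      ∀ a : V, supSeminorm V N (SchwartzMap.compSubConstCLM ℂ a f) ≤ C * (1 + ‖a‖) ^ m := by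
  refine ⟨2 ^ N.1 * (2 * supSeminorm V N f), N.1, by positivity, fun a => ?_⟩
  have h1 : 1 ≤ 1 + ‖a‖ := by simp
  refine supSeminorm_le (by positivity) fun k hk l hl =>
    (seminorm_compSubConst_le k l a f).trans ?_
  have e1 : SchwartzMap.seminorm ℂ k l f ≤ supSeminorm V N f * (1 + ‖a‖) ^ N.1 :=
    (seminorm_le_supSeminorm hk hl f).trans
      (le_mul_of_one_le_right (apply_nonneg _ _) (one_le_pow₀ h1))
  have e2 : ‖a‖ ^ k * SchwartzMap.seminorm ℂ 0 l f ≤ (1 + ‖a‖) ^ N.1 * supSeminorm V N f := by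
    gcongr
    · exact (pow_le_pow_left₀ (norm_nonneg a) (by simp) k).trans (pow_le_pow_right₀ h1 hk)
    · exact seminorm_le_supSeminorm (Nat.zero_le _) hl f
  calc _ ≤ 2 ^ N.1 * (supSeminorm V N f * (1 + ‖a‖) ^ N.1
        + (1 + ‖a‖) ^ N.1 * supSeminorm V N f) := by
        gcongr
        norm_num
    _ = _ := by ring

/-- Mean value inequality, with c in the role of the weight ‖x‖^k. Asking for the bound only near x
allows the weight at x to be compared with the weight at z. -/
theorem mul_norm_translate_sub_le {W : Type*} [NormedAddCommGroup W] [NormedSpace ℝ W] {F : V → W}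
    (hF : Differentiable ℝ F) {c C : ℝ} (hc : 0 ≤ c) {x a : V}
    (hbd : ∀ z ∈ Metric.closedBall x ‖a‖, c * ‖fderiv ℝ F z‖ ≤ C) :
    c * ‖F (x - a) - F x‖ ≤ C * ‖a‖ := by
  have := (convex_closedBall x ‖a‖).norm_image_sub_le_of_norm_fderiv_le (𝕜 := ℝ)
    (f := fun z => c • F z) (C := C) (x := x) (y := x - a) (fun z _ => (hF z).fun_const_smul c)
    (fun z hz => by
      rw [fderiv_fun_const_smul (hF z), norm_smul, Real.norm_of_nonneg hc]
      exact hbd z hz)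
    (Metric.mem_closedBall_self (norm_nonneg a)) (by simp)
  rw [← smul_sub, norm_smul, Real.norm_of_nonneg hc] at this
  simpa using this

theorem seminorm_compSubConst_sub_le (k l : ℕ) {a : V} (ha : ‖a‖ ≤ 1) (f : 𝓢(V, ℂ)) :
    SchwartzMap.seminorm ℂ k l (SchwartzMap.compSubConstCLM ℂ a f - f)
      ≤ 2 ^ k * (SchwartzMap.seminorm ℂ k (l + 1) f + SchwartzMap.seminorm ℂ 0 (l + 1) f)
        * ‖a‖ := by
  refine SchwartzMap.seminorm_le_bound ℂ k l _ (by positivity) fun x => ?_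
  rw [iteratedFDeriv_schwartz_sub, iteratedFDeriv_compSubConst]
  set C := 2 ^ k * (SchwartzMap.seminorm ℂ k (l + 1) f + SchwartzMap.seminorm ℂ 0 (l + 1) f)
  have hdiff : Differentiable ℝ (iteratedFDeriv ℝ l f) :=
    (f.smooth (l + 1)).differentiable_iteratedFDeriv (by exact_mod_cast Nat.lt_succ_self l)
  refine mul_norm_translate_sub_le hdiff (by positivity) fun z hz => ?_
  rw [norm_fderiv_iteratedFDeriv]
  have hxz : ‖z - x‖ ≤ 1 := (by simpa [dist_eq_norm] using hz : ‖z - x‖ ≤ ‖a‖).trans ha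
  have h2 := norm_pow_le_of_sub (x - z) x k
  rw [sub_sub_cancel, norm_sub_rev x z] at h2
  have h3 : ‖z - x‖ ^ k ≤ 1 := pow_le_one₀ (norm_nonneg _) hxz
  calc _ ≤ 2 ^ k * (‖z‖ ^ k + 1) * ‖iteratedFDeriv ℝ (l + 1) f z‖ := by
        gcongr
        exact h2.trans (by gcongr)
    _ = 2 ^ k * (‖z‖ ^ k * ‖iteratedFDeriv ℝ (l + 1) f z‖
          + ‖iteratedFDeriv ℝ (l + 1) f z‖) := by ring
    _ ≤ C := by
        refine mul_le_mul_of_nonneg_left (add_le_add ?_ ?_) (by positivity)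
        · exact SchwartzMap.le_seminorm ℂ k (l + 1) f _
        · exact SchwartzMap.norm_iteratedFDeriv_le_seminorm ℂ f (l + 1) _

theorem continuous_compSubConst (f : 𝓢(V, ℂ)) :
    Continuous fun a : V => SchwartzMap.compSubConstCLM ℂ a f := by
  have h0 : Tendsto (fun a : V => SchwartzMap.compSubConstCLM ℂ a f) (𝓝 0) (𝓝 f) := by
    rw [(schwartz_withSeminorms ℂ V ℂ).tendsto_nhds]
    rintro ⟨k, l⟩ ε hε
    have hlim : Tendsto (fun a : V => 2 ^ k * (SchwartzMap.seminorm ℂ k (l + 1) f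
        + SchwartzMap.seminorm ℂ 0 (l + 1) f) * ‖a‖) (𝓝 0) (𝓝 0) := by
      have := (continuous_norm (E := V)).tendsto 0
      simpa using this.const_mul (2 ^ k * (SchwartzMap.seminorm ℂ k (l + 1) f
        + SchwartzMap.seminorm ℂ 0 (l + 1) f))
    filter_upwards [hlim.eventually_lt_const hε, Metric.closedBall_mem_nhds (0 : V) one_pos]
      with a ha ha1
    exact (seminorm_compSubConst_sub_le k l (by simpa using ha1) f).trans_lt ha
  rw [continuous_iff_continuousAt]
  intro a₀
  have h1 : Tendsto (fun a : V => a - a₀) (𝓝 a₀) (𝓝 0) := by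
    have : Continuous fun a : V => a - a₀ := by fun_prop
    simpa using this.tendsto a₀
  -- Translation by a is translation by a - a₀ followed by the fixed continuous operator of
  -- translation by a₀, so continuity at 0 is enough.
  have h2 := ((SchwartzMap.compSubConstCLM ℂ a₀ (F := ℂ)).continuous.tendsto f).comp (h0.comp h1)
  refine h2.congr fun a => ?_
  simp

end Translation

/-! ### Products and modulations of Schwartz functions -/

section Product

variable {V : Type*} [NormedAddCommGroup V] [NormedSpace ℝ V]

/-- Multiplication by a Schwartz function. -/
def mulSchwartz (φ : 𝓢(V, ℂ)) : 𝓢(V, ℂ) →L[ℂ] 𝓢(V, ℂ) := SchwartzMap.smulLeftCLM ℂ φ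

@[simp]
theorem mulSchwartz_apply (φ η : 𝓢(V, ℂ)) (y : V) : mulSchwartz φ η y = φ y * η y := by
  simp [mulSchwartz, SchwartzMap.smulLeftCLM_apply_apply φ.hasTemperateGrowth]

/-- The two factors concentrate near 0 and near x: by (1 + ‖x‖) ≤ (1 + ‖y‖)(1 + ‖y - x‖) their decay
pays for any power of 1 + ‖x‖. The decay in x gives the integrability needed in `map_mul_integral`.
-/
theorem exists_supSeminorm_mulSchwartz_translate_le (N : ℕ × ℕ) (r : ℕ) (φ η : 𝓢(V, ℂ)) :
    ∃ C : ℝ, 0 ≤ C ∧ ∀ x : V,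
      (1 + ‖x‖) ^ r * supSeminorm V N (mulSchwartz φ (SchwartzMap.compSubConstCLM ℂ x η)) ≤ C := by
  set A := 2 ^ (N.1 + r) * supSeminorm V (N.1 + r, N.2) φ
  set B := 2 ^ r * supSeminorm V (r, N.2) η
  have hA : 0 ≤ A := by positivity
  have hB : 0 ≤ B := by positivity
  refine ⟨2 ^ N.2 * (A * B), by positivity, fun x => ?_⟩
  rw [mul_comm, ← le_div_iff₀ (by positivity)]
  refine supSeminorm_le (by positivity) fun k hk l hl => ?_
  refine SchwartzMap.seminorm_le_bound ℂ k l _ (by positivity) fun y => ?_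
  rw [le_div_iff₀ (by positivity)]
  have hprod : ((mulSchwartz φ (SchwartzMap.compSubConstCLM ℂ x η) : 𝓢(V, ℂ)) : V → ℂ)
      = fun y => φ y * SchwartzMap.compSubConstCLM ℂ x η y := by ext; simp
  have hL := norm_iteratedFDeriv_mul_le (φ.smooth l)
    ((SchwartzMap.compSubConstCLM ℂ x η).smooth l) y (n := l) le_rfl
  rw [hprod]
  have hx : (1 + ‖x‖) ^ r ≤ (1 + ‖y‖) ^ r * (1 + ‖y - x‖) ^ r := by
    rw [← mul_pow]
    gcongr
    have : ‖x‖ ≤ ‖y‖ + ‖y - x‖ := by simpa using norm_sub_le y (y - x)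
    nlinarith [norm_nonneg y, norm_nonneg (y - x), mul_nonneg (norm_nonneg y) (norm_nonneg (y - x))]
  have hterm : ∀ i ∈ Finset.range (l + 1),
      (1 + ‖y‖) ^ (N.1 + r) * (1 + ‖y - x‖) ^ r * ((l.choose i : ℝ) * ‖iteratedFDeriv ℝ i φ y‖ *
        ‖iteratedFDeriv ℝ (l - i) (SchwartzMap.compSubConstCLM ℂ x η) y‖)
      ≤ l.choose i * (A * B) := by
    intro i hi
    have hil : i ≤ l := Nat.lt_succ_iff.1 (Finset.mem_range.1 hi)
    rw [iteratedFDeriv_compSubConst]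
    have h1 : (1 + ‖y‖) ^ (N.1 + r) * ‖iteratedFDeriv ℝ i φ y‖ ≤ A :=
      SchwartzMap.one_add_le_sup_seminorm_apply (𝕜 := ℂ) (m := (N.1 + r, N.2)) le_rfl
        (hil.trans hl) φ y
    have h2 : (1 + ‖y - x‖) ^ r * ‖iteratedFDeriv ℝ (l - i) η (y - x)‖ ≤ B :=
      SchwartzMap.one_add_le_sup_seminorm_apply (𝕜 := ℂ) (m := (r, N.2)) le_rfl
        ((Nat.sub_le _ _).trans hl) η (y - x)
    calc _ = l.choose i * (((1 + ‖y‖) ^ (N.1 + r) * ‖iteratedFDeriv ℝ i φ y‖) *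
          ((1 + ‖y - x‖) ^ r * ‖iteratedFDeriv ℝ (l - i) η (y - x)‖)) := by ring
      _ ≤ _ := by gcongr
  have hyk : ‖y‖ ^ k ≤ (1 + ‖y‖) ^ N.1 :=
    (pow_le_pow_left₀ (norm_nonneg y) (by simp) k).trans (pow_le_pow_right₀ (by simp) hk)
  calc _ ≤ (1 + ‖y‖) ^ N.1 * (∑ i ∈ Finset.range (l + 1), (l.choose i : ℝ) *
        ‖iteratedFDeriv ℝ i φ y‖ *
        ‖iteratedFDeriv ℝ (l - i) (SchwartzMap.compSubConstCLM ℂ x η) y‖) *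
          ((1 + ‖y‖) ^ r * (1 + ‖y - x‖) ^ r) := by gcongr
    _ = ∑ i ∈ Finset.range (l + 1), (1 + ‖y‖) ^ (N.1 + r) * (1 + ‖y - x‖) ^ r *
          ((l.choose i : ℝ) * ‖iteratedFDeriv ℝ i φ y‖ *
        ‖iteratedFDeriv ℝ (l - i) (SchwartzMap.compSubConstCLM ℂ x η) y‖) := by
        rw [← Finset.mul_sum, pow_add]; ring
    _ ≤ ∑ i ∈ Finset.range (l + 1), (l.choose i : ℝ) * (A * B) := Finset.sum_le_sum hterm
    _ = 2 ^ l * (A * B) := by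
        rw [← Finset.sum_mul]
        congr 1
        exact_mod_cast Nat.sum_range_choose l
    _ ≤ _ := by gcongr; norm_num

end Product

/-! ### Plane waves, modulations, and distributions applied to products -/

section Modulation

variable {V : Type*} [NormedAddCommGroup V] [InnerProductSpace ℝ V]

/-- The character `y ↦ exp(2πi ⟨w, y⟩)`. -/
def planeWave (w y : V) : ℂ := Complex.exp ((2 * Real.pi * inner ℝ w y : ℝ) * Complex.I)

@[simp]
theorem norm_planeWave (w y : V) : ‖planeWave w y‖ = 1 := Complex.norm_exp_ofReal_mul_I _

@[fun_prop]
theorem continuous_planeWave : Continuous fun p : V × V => planeWave p.1 p.2 := by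
  unfold planeWave
  fun_prop

@[fun_prop]
theorem Continuous.planeWave {X : Type*} [TopologicalSpace X] {f g : X → V} (hf : Continuous f)
    (hg : Continuous g) : Continuous fun x => planeWave (f x) (g x) :=
  continuous_planeWave.comp (hf.prodMk hg)

theorem planeWave_comm (w y : V) : planeWave w y = planeWave y w := by
  rw [planeWave, planeWave, real_inner_comm]

theorem planeWave_add_left (w v y : V) : planeWave (w + v) y = planeWave w y * planeWave v y := by
  rw [planeWave, planeWave, planeWave, ← Complex.exp_add, inner_add_left]
  push_cast
  ring_nf

theorem planeWave_add_right (w y z : V) :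
    planeWave w (y + z) = planeWave w y * planeWave w z := by
  rw [planeWave_comm, planeWave_add_left, planeWave_comm y, planeWave_comm z]

@[simp]
theorem planeWave_zero_left (y : V) : planeWave 0 y = 1 := by simp [planeWave]

theorem planeWave_smul_comm (t : ℝ) (w y : V) : planeWave (t • w) y = planeWave w (t • y) := by
  rw [planeWave, planeWave, inner_smul_left, inner_smul_right]; simp

variable [FiniteDimensional ℝ V] [MeasurableSpace V] [BorelSpace V]

theorem fourier_eq_planeWave (f : V → ℂ) (w : V) : 𝓕 f w = ∫ v, planeWave (-w) v * f v := by
  rw [Real.fourier_eq']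
  refine integral_congr_ae (ae_of_all _ fun v => ?_)
  simp only [planeWave, smul_eq_mul, inner_neg_left, real_inner_comm]
  ring_nf

theorem fourierInv_eq_planeWave (f : V → ℂ) (w : V) : 𝓕⁻ f w = ∫ v, planeWave w v * f v := by
  rw [Real.fourierInv_eq']
  refine integral_congr_ae (ae_of_all _ fun v => ?_)
  simp only [planeWave, smul_eq_mul, real_inner_comm]

theorem fourier_schwartz_apply (f : 𝓢(V, ℂ)) (w : V) :
    (𝓕 f : 𝓢(V, ℂ)) w = ∫ v, planeWave (-w) v * f v := by
  rw [SchwartzMap.fourier_coe, fourier_eq_planeWave]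

theorem fourierInv_schwartz_apply (f : 𝓢(V, ℂ)) (w : V) :
    (𝓕⁻ f : 𝓢(V, ℂ)) w = ∫ v, planeWave w v * f v := by
  rw [SchwartzMap.fourierInv_coe, fourierInv_eq_planeWave]

theorem integrable_planeWave_mul {f : V → ℂ} (hf : Integrable f) (w : V) :
    Integrable fun v => planeWave w v * f v :=
  hf.bdd_mul (by fun_prop : Continuous _).aestronglyMeasurable
    (ae_of_all _ fun v => (norm_planeWave w v).le)

theorem norm_fourierInv_le {f : V → ℂ} (w : V) : ‖𝓕⁻ f w‖ ≤ ∫ v, ‖f v‖ := by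
  rw [fourierInv_eq_planeWave]
  refine (norm_integral_le_integral_norm _).trans_eq ?_
  simp

theorem continuous_fourierInv_of_integrable {f : V → ℂ} (hf : Integrable f) :
    Continuous (𝓕⁻ f) := by
  have : 𝓕⁻ f = fun w => ∫ v, planeWave w v * f v := funext (fourierInv_eq_planeWave f)
  rw [this]
  refine continuous_of_dominated (fun w => (integrable_planeWave_mul hf w).aestronglyMeasurable)
    (fun w => ae_of_all _ fun v => ?_) hf.norm (ae_of_all _ fun v => by fun_prop)
  simp

theorem continuous_fourier_of_integrable {f : V → ℂ} (hf : Integrable f) :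
    Continuous (𝓕 f) := by
  have := (continuous_fourierInv_of_integrable hf).comp (continuous_neg (G := V))
  convert this using 1
  ext w
  simp [Real.fourierInv_eq_fourier_neg]

/-- Modulation `y ↦ exp(2πi ⟨w, y⟩) h(y)` of a Schwartz function. -/
def modulate (w : V) (h : 𝓢(V, ℂ)) : 𝓢(V, ℂ) :=
  𝓕⁻ (SchwartzMap.compSubConstCLM ℂ w (𝓕 h))

@[simp]
theorem modulate_apply (w : V) (h : 𝓢(V, ℂ)) (y : V) : modulate w h y = planeWave w y * h y := by
  have h1 : h y = ∫ v, planeWave y v * (𝓕 h : 𝓢(V, ℂ)) v := by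
    rw [← fourierInv_schwartz_apply, FourierTransform.fourierInv_fourier_eq]
  rw [modulate, fourierInv_schwartz_apply, h1,
    ← integral_add_right_eq_self (fun v => planeWave y v * _) w, ← integral_const_mul]
  refine integral_congr_ae (ae_of_all _ fun v => ?_)
  simp only [SchwartzMap.compSubConstCLM_apply, add_sub_cancel_right, planeWave_add_right]
  rw [planeWave_comm y w]
  ring

theorem continuous_modulate (h : 𝓢(V, ℂ)) : Continuous fun w => modulate w h :=
  (FourierTransform.fourierInvCLM ℂ 𝓢(V, ℂ)).continuous.comp (continuous_compSubConst _)

/-- Modulation is translation conjugated by the Fourier transform, and translation costs only a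
polynomial factor. -/
theorem exists_supSeminorm_modulate_le (N : ℕ × ℕ) (h : 𝓢(V, ℂ)) :
    ∃ (C : ℝ) (m : ℕ), 0 ≤ C ∧ ∀ w : V, supSeminorm V N (modulate w h) ≤ C * (1 + ‖w‖) ^ m := by
  obtain ⟨N', C', hC', h'⟩ := exists_le_supSeminorm
    ((supSeminorm V N).comp (FourierTransform.fourierInvCLM ℂ 𝓢(V, ℂ)).toLinearMap)
    ((continuous_supSeminorm N).comp (FourierTransform.fourierInvCLM ℂ 𝓢(V, ℂ)).continuous)
  obtain ⟨C, m, hC, hb⟩ := exists_supSeminorm_compSubConst_le N' (𝓕 h)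
  refine ⟨C' * C, m, by positivity, fun w => (h' _).trans ?_⟩
  rw [mul_assoc]
  exact mul_le_mul_of_nonneg_left (hb w) hC'

theorem integrable_one_add_pow_mul_norm (ψ : 𝓢(V, ℂ)) (m : ℕ) :
    Integrable fun w => (1 + ‖w‖) ^ m * ‖ψ w‖ := by
  have h1 := ((ψ.integrable (μ := volume)).norm.add (ψ.integrable_pow_mul volume m)).const_mul
    (2 ^ (m - 1))
  refine h1.mono' (by fun_prop) (ae_of_all _ fun w => ?_)
  rw [Real.norm_of_nonneg (by positivity)]
  calc _ ≤ 2 ^ (m - 1) * (1 ^ m + ‖w‖ ^ m) * ‖ψ w‖ := by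
        gcongr
        exact add_pow_le zero_le_one (norm_nonneg w) m
    _ = _ := by simp; ring

/-- A tempered distribution applied to `h · 𝓕 ψ`. -/
theorem map_mul_fourier (T : 𝓢(V, ℂ) →L[ℂ] ℂ) (h ψ : 𝓢(V, ℂ)) :
    T (mulSchwartz h (𝓕 ψ)) = ∫ w, ψ w * T (modulate (-w) h) := by
  rw [map_integral_schwartz (μ := volume) T (fun w => ψ w • modulate (-w) h)]
  · simp
  · exact ψ.continuous.smul ((continuous_modulate h).comp continuous_neg)
  · intro N
    obtain ⟨C, m, hC, hb⟩ := exists_supSeminorm_modulate_le N h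
    refine ((integrable_one_add_pow_mul_norm ψ m).const_mul C).mono'
      ((continuous_supSeminorm N).comp
        (ψ.continuous.smul ((continuous_modulate h).comp continuous_neg))).aestronglyMeasurable
      (ae_of_all _ fun w => ?_)
    rw [Real.norm_of_nonneg (apply_nonneg _ _), map_smul_eq_mul]
    calc _ ≤ ‖ψ w‖ * (C * (1 + ‖-w‖) ^ m) := by gcongr; exact hb _
      _ = _ := by rw [norm_neg]; ring
  · intro y
    simp only [mulSchwartz_apply, smul_apply, modulate_apply, smul_eq_mul]
    rw [fourier_schwartz_apply, ← integral_const_mul]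
    refine integral_congr_ae (ae_of_all _ fun v => ?_)
    have : planeWave (-y) v = planeWave (-v) y := by
      rw [planeWave, planeWave, inner_neg_left, inner_neg_left, real_inner_comm]
    simp only [this]
    ring

/-- A continuous partition of the test function `φ` by the translates of `η`. -/
theorem map_mul_integral (T : 𝓢(V, ℂ) →L[ℂ] ℂ) (φ η : 𝓢(V, ℂ)) :
    (∫ y, η y) * T φ = ∫ x, T (mulSchwartz φ (SchwartzMap.compSubConstCLM ℂ x η)) := by
  have hcont : Continuous fun x => mulSchwartz φ (SchwartzMap.compSubConstCLM ℂ x η) :=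
    (mulSchwartz φ).continuous.comp (continuous_compSubConst η)
  rw [← smul_eq_mul, ← map_smul, map_integral_schwartz (μ := volume) T _ hcont]
  · intro N
    obtain ⟨C, hC, hb⟩ := exists_supSeminorm_mulSchwartz_translate_le N
      (Module.finrank ℝ V + 1) φ η
    have hdec : Integrable fun x : V => (1 + ‖x‖) ^ (-((Module.finrank ℝ V + 1 : ℕ) : ℝ)) :=
      integrable_one_add_norm (by push_cast; linarith)
    refine (hdec.const_mul C).mono'
      ((continuous_supSeminorm N).comp hcont).aestronglyMeasurable (ae_of_all _ fun x => ?_)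
    have hpos : (0 : ℝ) < 1 + ‖x‖ := by positivity
    rw [Real.norm_of_nonneg (apply_nonneg _ _), Real.rpow_neg hpos.le, Real.rpow_natCast,
      ← div_eq_mul_inv, le_div_iff₀ (by positivity), mul_comm]
    exact hb x
  · intro y
    simp only [mulSchwartz_apply, smul_apply, smul_eq_mul, SchwartzMap.compSubConstCLM_apply]
    rw [integral_const_mul, integral_sub_left_eq_self (fun z => η z) volume y, mul_comm]

end Modulation

/-! ### Elements of the Sjöstrand class are bounded continuous functions -/

section Representation

variable {V : Type*} [NormedAddCommGroup V] [InnerProductSpace ℝ V] [FiniteDimensional ℝ V]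
  [MeasurableSpace V] [BorelSpace V]

theorem integral_fourierInv_mul_eq {f g : V → ℂ} (hf : Integrable f) (hg : Integrable g) :
    ∫ w, 𝓕⁻ f w * g w = ∫ v, f v * 𝓕⁻ g v := by
  have h := VectorFourier.integral_fourierIntegral_smul_eq_flip (L := innerₗ V)
    Real.continuous_fourierChar continuous_inner hf.comp_neg hg
  have h1 : ∀ w, VectorFourier.fourierIntegral Real.fourierChar volume (innerₗ V)
      (fun x => f (-x)) w = 𝓕⁻ f w := fun w => by
    rw [Real.fourierInv_eq_fourier_comp_neg]; rfl
  have h2 : ∀ v, VectorFourier.fourierIntegral Real.fourierChar volume (innerₗ V).flip g v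
      = 𝓕 g v := fun v => by rw [flip_innerₗ]; rfl
  simp only [h1, h2, smul_eq_mul] at h
  rw [h, ← integral_neg_eq_self]
  simp [Real.fourierInv_eq_fourier_neg]

theorem eq_of_forall_integral_schwartz_mul_eq {F G : V → ℂ} (hF : Continuous F) (hG : Continuous G)
    (h : ∀ χ : 𝓢(V, ℂ), ∫ y, χ y * F y = ∫ y, χ y * G y) : F = G := by
  refine (hF.ae_eq_iff_eq volume hG).1 (ae_eq_of_integral_contDiff_smul_eq
    hF.locallyIntegrable hG.locallyIntegrable fun g hg hgc => ?_)
  have hc : HasCompactSupport fun y => (g y : ℂ) := hgc.comp_left Complex.ofReal_zero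
  simp only [Complex.real_smul]
  exact h (hc.toSchwartzMap (Complex.ofRealCLM.contDiff.comp hg))

theorem integrable_mul_translate {F G : V → ℂ} (hF : Integrable F) (hG : Integrable G) :
    Integrable (fun p : V × V => F p.2 * G (p.2 - p.1)) (volume.prod volume) := by
  refine ((hF.convolution_integrand (ContinuousLinearMap.mul ℂ ℂ) hG.comp_neg)).congr
    (ae_of_all _ fun p => ?_)
  simp

theorem integrable_of_enorm_le {u : V → ℂ} (hu : Continuous u) {M : V → ℝ≥0∞}
    (hM : ∫⁻ w, M w < ⊤) (h : ∀ w, ‖u w‖ₑ ≤ M w) : Integrable u :=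
  ⟨hu.aestronglyMeasurable, (lintegral_mono h).trans_lt hM⟩

/-- A tempered distribution whose short-time Fourier transform with window `h` is dominated by an
integrable function of the frequency alone is a bounded continuous function. -/
theorem exists_boundedContinuous_representation (T : 𝓢(V, ℂ) →L[ℂ] ℂ) (h k : 𝓢(V, ℂ))
    (hk : ∫ y, k y * h y ≠ 0) (M : V → ℝ≥0∞) (hM : ∫⁻ w, M w < ⊤)
    (hTM : ∀ x w, ‖T (modulate (-w) (SchwartzMap.compSubConstCLM ℂ x h))‖ₑ ≤ M w) :
    ∃ f : V →ᵇ ℂ, ∀ φ : 𝓢(V, ℂ), T φ = ∫ y, f y * φ y := by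
  set τ : V → 𝓢(V, ℂ) → 𝓢(V, ℂ) := fun x => SchwartzMap.compSubConstCLM ℂ x with hτ
  set U : V → V → ℂ := fun x w => T (modulate (-w) (τ x h)) with hU
  have hUcont : ∀ x, Continuous (U x) := fun x =>
    T.continuous.comp ((continuous_modulate _).comp continuous_neg)
  have hUint : ∀ x, Integrable (U x) := fun x => integrable_of_enorm_le (hUcont x) hM (hTM x)
  set u : V → V → ℂ := fun x => 𝓕⁻ (U x) with hu
  have hucont : ∀ x, Continuous (u x) := fun x => continuous_fourierInv_of_integrable (hUint x)
  have hubd : ∀ x y, ‖u x y‖ ≤ (∫⁻ w, M w).toReal := fun x y => by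
    refine (norm_fourierInv_le y).trans ?_
    rw [integral_norm_eq_lintegral_enorm (hUint x).aestronglyMeasurable]
    exact ENNReal.toReal_mono hM.ne (lintegral_mono (hTM x))
  have hTu : ∀ x (χ : 𝓢(V, ℂ)), T (mulSchwartz χ (τ x h)) = ∫ y, χ y * u x y := fun x χ => by
    have h1 : mulSchwartz χ (τ x h) = mulSchwartz (τ x h) (𝓕 (𝓕⁻ χ)) := by
      rw [FourierTransform.fourier_fourierInv_eq]
      ext y
      simp [mul_comm]
    rw [h1, map_mul_fourier, ← integral_fourierInv_mul_eq χ.integrable (hUint x)]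
    simp only [SchwartzMap.fourierInv_coe]
    rfl
  -- u x is the density of T multiplied by the translate of h to x, so both sides are densities of T
  -- multiplied by both translates.
  have hcomp : ∀ x x' y, h (y - x') * u x y = h (y - x) * u x' y := by
    intro x x'
    refine fun y => congrFun (eq_of_forall_integral_schwartz_mul_eq
      (F := fun y => h (y - x') * u x y) (G := fun y => h (y - x) * u x' y)
      ((h.continuous.comp (by fun_prop)).mul (hucont x))
      ((h.continuous.comp (by fun_prop)).mul (hucont x')) fun χ => ?_) y
    have e1 := hTu x (mulSchwartz χ (τ x' h))
    have e2 := hTu x' (mulSchwartz χ (τ x h))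
    have e3 : mulSchwartz (mulSchwartz χ (τ x' h)) (τ x h)
        = mulSchwartz (mulSchwartz χ (τ x h)) (τ x' h) := by
      ext y
      simp only [mulSchwartz_apply]
      ring
    rw [e3, e2] at e1
    simp only [mulSchwartz_apply, hτ, SchwartzMap.compSubConstCLM_apply, mul_assoc] at e1
    exact e1.symm
  obtain ⟨x₀, hx₀⟩ : ∃ x₀, h x₀ ≠ 0 := by
    by_contra hcon
    push Not at hcon
    exact hk (by simp [hcon])
  -- Taking x = y - x₀ makes the denominator h (y - x) the constant h x₀, so the bound on u passes
  -- to f₀.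
  set f₀ : V → ℂ := fun y => u (y - x₀) y / h x₀ with hf₀
  have hf₀h : ∀ x y, f₀ y * h (y - x) = u x y := fun x y => by
    have := hcomp x (y - x₀) y
    rw [sub_sub_cancel] at this
    simp only [hf₀]
    field_simp
    rw [this, mul_comm]
  have hf₀cont : Continuous f₀ := by
    rw [continuous_iff_continuousAt]
    intro y₁
    have hh : Continuous fun y => h (y - (y₁ - x₀)) := h.continuous.comp (by fun_prop)
    have hne : h (y₁ - (y₁ - x₀)) ≠ 0 := by rwa [sub_sub_cancel]
    -- As x moves with y in the definition of f₀, continuity is checked with x frozen at y₁ - x₀,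
    -- where f₀ is locally a quotient of continuous functions.
    refine ((hucont (y₁ - x₀)).continuousAt.div hh.continuousAt hne).congr ?_
    filter_upwards [hh.continuousAt.eventually_ne hne] with y hy
    rw [Pi.div_apply, ← hf₀h, mul_div_cancel_right₀ _ hy]
  have hf₀bd : ∀ y, ‖f₀ y‖ ≤ (∫⁻ w, M w).toReal / ‖h x₀‖ := fun y => by
    rw [hf₀, norm_div]
    gcongr
    exact hubd _ _
  refine ⟨BoundedContinuousFunction.ofNormedAddCommGroup f₀ hf₀cont _ hf₀bd, fun φ => ?_⟩
  have hφ : Integrable fun y => f₀ y * φ y :=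
    (φ.integrable (μ := volume)).bdd_mul hf₀cont.aestronglyMeasurable (ae_of_all _ hf₀bd)
  -- Translates of η = k h partition φ, and their factor h lets each piece be evaluated through u.
  set η := mulSchwartz k h with hη
  have hη0 : ∫ y, η y ≠ 0 := by simpa [hη] using hk
  refine mul_left_cancel₀ hη0 ?_
  rw [map_mul_integral]
  calc ∫ x, T (mulSchwartz φ (τ x η))
      = ∫ x, ∫ y, f₀ y * φ y * η (y - x) := by
        refine integral_congr_ae (ae_of_all _ fun x => ?_)
        have e1 : mulSchwartz φ (τ x η) = mulSchwartz (mulSchwartz φ (τ x k)) (τ x h) := by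
          ext y
          simp only [mulSchwartz_apply, hη, hτ, SchwartzMap.compSubConstCLM_apply]
          ring
        simp only [e1, hTu, ← hf₀h]
        refine integral_congr_ae (ae_of_all _ fun y => ?_)
        simp only [mulSchwartz_apply, hη, hτ, SchwartzMap.compSubConstCLM_apply]
        ring
    _ = ∫ y, ∫ x, f₀ y * φ y * η (y - x) :=
        integral_integral_swap (integrable_mul_translate hφ η.integrable)
    _ = ∫ y, f₀ y * φ y * ∫ x, η x := by
        refine integral_congr_ae (ae_of_all _ fun y => ?_)
        simp only
        rw [integral_const_mul, integral_sub_left_eq_self (fun z => η z) volume y]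
    _ = _ := by
        rw [integral_mul_const, mul_comm]
        rfl

end Representation

/-! ### Oscillatory integrals against quadratic phases -/

section Chirp

variable {V : Type*} [NormedAddCommGroup V]

/-- The quadratic phase `y ↦ exp(πia|y|²)`. -/
def chirp (a : ℝ) (y : V) : ℂ := Complex.exp ((Real.pi * a * ‖y‖ ^ 2 : ℝ) * Complex.I)

@[simp]
theorem norm_chirp (a : ℝ) (y : V) : ‖chirp a y‖ = 1 := Complex.norm_exp_ofReal_mul_I _

@[fun_prop]
theorem continuous_chirp (a : ℝ) : Continuous (chirp a : V → ℂ) := by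
  unfold chirp
  fun_prop

end Chirp

/-! ### Regularized Fresnel integrals through the short-time Fourier transform -/

section Oscillatory

variable {V : Type*} [NormedAddCommGroup V] [InnerProductSpace ℝ V]

/-- In a‖y‖² - a‖y - x‖² the terms quadratic in y cancel. -/
theorem chirp_mul_chirp_neg_sub (a : ℝ) (x y : V) :
    chirp a y * chirp (-a) (y - x) = chirp (-a) x * planeWave (a • x) y := by
  rw [chirp, chirp, chirp, planeWave, ← Complex.exp_add, ← Complex.exp_add, norm_sub_sq_real,
    real_inner_smul_left, real_inner_comm]
  push_cast
  ring_nf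

theorem exists_norm_le_one_add_norm_rpow (f : 𝓢(V, ℂ)) (r : ℕ) :
    ∃ A : ℝ, 0 ≤ A ∧ ∀ v, ‖f v‖ ≤ A * (1 + ‖v‖) ^ (-(r : ℝ)) := by
  refine ⟨2 ^ r * supSeminorm V (r, 0) f, by positivity, fun v => ?_⟩
  have h := SchwartzMap.one_add_le_sup_seminorm_apply (𝕜 := ℂ) (m := (r, 0)) (k := r) (n := 0)
    le_rfl le_rfl f v
  rw [norm_iteratedFDeriv_zero] at h
  have hpos : (0 : ℝ) < 1 + ‖v‖ := by positivity
  rw [Real.rpow_neg hpos.le, Real.rpow_natCast, ← div_eq_mul_inv, le_div_iff₀ (by positivity),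
    mul_comm]
  exact h

variable [FiniteDimensional ℝ V] [MeasurableSpace V] [BorelSpace V]

theorem lintegral_comp_smul {F : V → ℝ≥0∞} (hF : Measurable F) {r : ℝ} (hr : r ≠ 0) :
    ∫⁻ x, F (r • x) = ENNReal.ofReal |(r ^ Module.finrank ℝ V)⁻¹| * ∫⁻ x, F x := by
  rw [← lintegral_map (μ := volume) (g := fun x : V => r • x) hF (measurable_const_smul r),
    Measure.map_addHaar_smul volume hr, lintegral_smul_measure, smul_eq_mul]

theorem fourierInv_compSubConst (Γ : 𝓢(V, ℂ)) (x v : V) :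
    𝓕⁻ (fun y => Γ (y - x)) v = planeWave v x * (𝓕⁻ Γ : 𝓢(V, ℂ)) v := by
  rw [fourierInv_eq_planeWave, fourierInv_schwartz_apply, ← integral_const_mul,
    ← integral_add_right_eq_self _ x]
  refine integral_congr_ae (ae_of_all _ fun y => ?_)
  simp only [add_sub_cancel_right, planeWave_add_right]
  ring

/-- The regularized Fourier integral `∫ exp(2πi⟨v, y⟩) Γ(y - x) φ(εy) dy`. -/
def cutoffFourier (Γ φ : 𝓢(V, ℂ)) (ε : ℝ) (x v : V) : ℂ :=
  ∫ y, planeWave v y * (Γ (y - x) * φ (ε • y))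

theorem integrable_translate_mul_cutoff (Γ φ : 𝓢(V, ℂ)) (ε : ℝ) (x : V) :
    Integrable fun y => Γ (y - x) * φ (ε • y) :=
  ((Γ.integrable (μ := volume)).comp_sub_right x).mul_bdd
    (φ.continuous.comp (by fun_prop)).aestronglyMeasurable
    (ae_of_all _ fun y => SchwartzMap.norm_le_seminorm ℂ φ (ε • y))

theorem continuous_cutoffFourier (Γ φ : 𝓢(V, ℂ)) (ε : ℝ) (x : V) :
    Continuous (cutoffFourier Γ φ ε x) := by
  have : cutoffFourier Γ φ ε x = 𝓕⁻ fun y => Γ (y - x) * φ (ε • y) :=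
    funext fun v => (fourierInv_eq_planeWave _ v).symm
  rw [this]
  exact continuous_fourierInv_of_integrable (integrable_translate_mul_cutoff Γ φ ε x)

/-- Fourier inversion for φ shows that the cutoff merely averages over frequencies at scale ε. -/
theorem cutoffFourier_eq (Γ φ : 𝓢(V, ℂ)) (ε : ℝ) (x v : V) :
    cutoffFourier Γ φ ε x v = ∫ η, (𝓕 φ : 𝓢(V, ℂ)) η *
      (planeWave (v + ε • η) x * (𝓕⁻ Γ : 𝓢(V, ℂ)) (v + ε • η)) := by
  have hφ : ∀ y, φ y = ∫ η, planeWave y η * (𝓕 φ : 𝓢(V, ℂ)) η := fun y => by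
    rw [← fourierInv_schwartz_apply, FourierTransform.fourierInv_fourier_eq]
  have hΓ : Integrable fun y => Γ (y - x) := (Γ.integrable (μ := volume)).comp_sub_right x
  calc cutoffFourier Γ φ ε x v
      = ∫ y, ∫ η, planeWave (v + ε • η) y * (Γ (y - x) * (𝓕 φ : 𝓢(V, ℂ)) η) := by
        refine integral_congr_ae (ae_of_all _ fun y => ?_)
        simp only
        rw [hφ, ← integral_const_mul, ← integral_const_mul]
        refine integral_congr_ae (ae_of_all _ fun η => ?_)
        simp only
        rw [planeWave_add_left, planeWave_smul_comm ε η, planeWave_comm η]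
        ring
    _ = ∫ η, ∫ y, planeWave (v + ε • η) y * (Γ (y - x) * (𝓕 φ : 𝓢(V, ℂ)) η) := by
        refine integral_integral_swap ?_
        refine (hΓ.mul_prod (𝓕 φ).integrable).bdd_mul (c := 1)
          (f := fun p : V × V => planeWave (v + ε • p.2) p.1)
          (by fun_prop : Continuous _).aestronglyMeasurable (ae_of_all _ fun p => ?_)
        simp
    _ = _ := by
        refine integral_congr_ae (ae_of_all _ fun η => ?_)
        simp only
        rw [← fourierInv_compSubConst, fourierInv_eq_planeWave, ← integral_const_mul]
        refine integral_congr_ae (ae_of_all _ fun y => ?_)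
        simp only
        ring

/-- Uniformity in ε and x provides the majorant for dominated convergence; the shift by ε • η costs
(1 + ‖η‖)^r, absorbed by the decay of 𝓕 φ. -/
theorem exists_norm_cutoffFourier_le (Γ φ : 𝓢(V, ℂ)) (r : ℕ) :
    ∃ C : ℝ, 0 ≤ C ∧ ∀ ε : ℝ, |ε| ≤ 1 → ∀ x v,
      ‖cutoffFourier Γ φ ε x v‖ ≤ C * (1 + ‖v‖) ^ (-(r : ℝ)) := by
  obtain ⟨A, hA, hΓ⟩ := exists_norm_le_one_add_norm_rpow (𝓕⁻ Γ) r
  have hint := integrable_one_add_pow_mul_norm (𝓕 φ : 𝓢(V, ℂ)) r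
  refine ⟨A * ∫ η, (1 + ‖η‖) ^ r * ‖(𝓕 φ : 𝓢(V, ℂ)) η‖,
    mul_nonneg hA (integral_nonneg fun η => by positivity), fun ε hε x v => ?_⟩
  rw [cutoffFourier_eq, mul_right_comm, ← integral_const_mul]
  refine norm_integral_le_of_norm_le (hint.const_mul _) (ae_of_all _ fun η => ?_)
  rw [norm_mul, norm_mul, norm_planeWave, one_mul]
  have hpos : ∀ z : V, (0 : ℝ) < 1 + ‖z‖ := fun z => by positivity
  have hv : 1 + ‖v‖ ≤ (1 + ‖v + ε • η‖) * (1 + ‖η‖) := by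
    have h1 : ‖v‖ ≤ ‖v + ε • η‖ + ‖η‖ := by
      calc ‖v‖ = ‖(v + ε • η) - ε • η‖ := by rw [add_sub_cancel_right]
        _ ≤ ‖v + ε • η‖ + ‖ε • η‖ := norm_sub_le _ _
        _ ≤ _ := by
          rw [norm_smul, Real.norm_eq_abs]
          gcongr
          exact mul_le_of_le_one_left (norm_nonneg _) hε
    nlinarith [norm_nonneg η, norm_nonneg (v + ε • η),
      mul_nonneg (norm_nonneg η) (norm_nonneg (v + ε • η))]
  have hinv : (1 + ‖v + ε • η‖) ^ (-(r : ℝ)) ≤ (1 + ‖v‖) ^ (-(r : ℝ)) * (1 + ‖η‖) ^ r := by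
    rw [Real.rpow_neg (hpos _).le, Real.rpow_neg (hpos _).le, Real.rpow_natCast, Real.rpow_natCast,
      inv_mul_eq_div, le_div_iff₀ (pow_pos (hpos _) _), inv_mul_le_iff₀ (pow_pos (hpos _) _),
      ← mul_pow]
    gcongr
  calc _ ≤ ‖(𝓕 φ : 𝓢(V, ℂ)) η‖ * (A * ((1 + ‖v‖) ^ (-(r : ℝ)) * (1 + ‖η‖) ^ r)) := by
        gcongr
        exact (hΓ _).trans (by gcongr)
    _ = _ := by ring

theorem tendsto_cutoffFourier (Γ φ : 𝓢(V, ℂ)) (hφ : φ 0 = 1) (x v : V) :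
    Tendsto (fun ε => cutoffFourier Γ φ ε x v) (𝓝 0)
      (𝓝 (planeWave v x * (𝓕⁻ Γ : 𝓢(V, ℂ)) v)) := by
  rw [← fourierInv_compSubConst, fourierInv_eq_planeWave]
  have hΓ : Integrable fun y => Γ (y - x) := (Γ.integrable (μ := volume)).comp_sub_right x
  refine tendsto_integral_filter_of_dominated_convergence
    (fun y => ‖Γ (y - x)‖ * SchwartzMap.seminorm ℂ 0 0 φ)
    (Eventually.of_forall fun ε =>
      (integrable_planeWave_mul (integrable_translate_mul_cutoff Γ φ ε x) v).aestronglyMeasurable)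
    (Eventually.of_forall fun ε => ae_of_all _ fun y => ?_) (hΓ.norm.mul_const _)
    (ae_of_all _ fun y => ?_)
  · rw [norm_mul, norm_mul, norm_planeWave, one_mul]
    gcongr
    exact SchwartzMap.norm_le_seminorm ℂ φ _
  · have h1 : Tendsto (fun ε : ℝ => φ (ε • y)) (𝓝 0) (𝓝 1) := by
      have : Continuous fun ε : ℝ => φ (ε • y) := φ.continuous.comp (by fun_prop)
      simpa [hφ] using this.tendsto 0
    simpa using (h1.const_mul (Γ (y - x))).const_mul (planeWave v y)

theorem integrable_comp_cutoff {φ : 𝓢(V, ℂ)} {ε : ℝ} (hε : ε ≠ 0) {f : V → ℂ} (hf : Continuous f)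
    {B : ℝ} (hB : ∀ y, ‖f y‖ ≤ B) : Integrable fun y => f y * φ (ε • y) :=
  ((φ.integrable (μ := volume)).comp_smul hε).bdd_mul hf.aestronglyMeasurable (ae_of_all _ hB)

/-- The Fresnel integral, regularized by `φ(εy)`, in terms of the short-time Fourier transform. -/
theorem fresnel_regularized_eq {a ε : ℝ} (hε : ε ≠ 0) (f : V →ᵇ ℂ) (h Γ φ : 𝓢(V, ℂ))
    (hint : ∀ x, Integrable (𝓕 fun y => f y * h (y - x))) :
    Integrable (fun x : V => chirp (-a) x *
      ∫ w, 𝓕 (fun y => f y * h (y - x)) w * cutoffFourier Γ φ ε x (w + a • x)) ∧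
    (∫ u : V, chirp (-a) u * (Γ u * h u)) * ∫ y : V, chirp a y * f y * φ (ε • y)
      = ∫ x : V, chirp (-a) x *
          ∫ w, 𝓕 (fun y => f y * h (y - x)) w * cutoffFourier Γ φ ε x (w + a • x) := by
  have hF : Integrable fun y => chirp a y * f y * φ (ε • y) :=
    integrable_comp_cutoff hε ((continuous_chirp a).mul f.continuous) (B := ‖f‖) fun y => by
      simpa using f.norm_coe_le_norm y
  have hG : Integrable fun u : V => chirp (-a) u * (Γ u * h u) := by
    have : Integrable fun u => Γ u * h u := ((mulSchwartz Γ h).integrable (μ := volume)).congr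
      (ae_of_all _ fun u => mulSchwartz_apply Γ h u)
    exact this.bdd_mul (continuous_chirp _).aestronglyMeasurable
      (ae_of_all _ fun u => (norm_chirp _ _).le)
  -- Joint integrability, so that the double integral may be taken in x first, giving κ times the
  -- Fresnel integral, or in y first.
  have hprod := integrable_mul_translate hF hG
  have hinner : ∀ x, ∫ y, (chirp a y * f y * φ (ε • y)) *
      (chirp (-a) (y - x) * (Γ (y - x) * h (y - x))) = chirp (-a) x *
        ∫ w, 𝓕 (fun y => f y * h (y - x)) w * cutoffFourier Γ φ ε x (w + a • x) := by
    intro x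
    have hfh : Integrable fun y => f y * h (y - x) :=
      ((h.integrable (μ := volume)).comp_sub_right x).bdd_mul f.continuous.aestronglyMeasurable
        (ae_of_all _ f.norm_coe_le_norm)
    have hinv : 𝓕⁻ (𝓕 fun y => f y * h (y - x)) = fun y => f y * h (y - x) :=
      Continuous.fourierInv_fourier_eq
        (f.continuous.mul (h.continuous.comp (by fun_prop))) hfh (hint x)
    have hP := integrable_planeWave_mul (integrable_translate_mul_cutoff Γ φ ε x) (a • x)
    -- Parseval moves the linear phase `a • x` onto the second factor as a shift of frequency.
    have hPar := integral_fourierInv_mul_eq (hint x) hP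
    rw [hinv] at hPar
    have hK : ∀ w, 𝓕⁻ (fun v => planeWave (a • x) v * (Γ (v - x) * φ (ε • v))) w
        = cutoffFourier Γ φ ε x (w + a • x) := fun w => by
      rw [fourierInv_eq_planeWave, cutoffFourier]
      refine integral_congr_ae (ae_of_all _ fun y => ?_)
      simp only [planeWave_add_left, mul_assoc]
    simp only [hK] at hPar
    rw [← hPar, ← integral_const_mul]
    refine integral_congr_ae (ae_of_all _ fun y => ?_)
    simp only
    linear_combination (f y * φ (ε • y) * Γ (y - x) * h (y - x)) * chirp_mul_chirp_neg_sub a x y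
  constructor
  · exact hprod.integral_prod_left.congr (ae_of_all _ hinner)
  · rw [← integral_congr_ae (ae_of_all _ hinner), integral_integral_swap hprod, mul_comm,
      ← integral_mul_const]
    refine integral_congr_ae (ae_of_all _ fun y => ?_)
    simp only
    rw [integral_const_mul,
      integral_sub_left_eq_self (fun u => chirp (-a) u * (Γ u * h u)) volume y]

/-- For fixed w the substitution v = w + ax decouples the variables; this is where the absence of x
in m is used. -/
theorem integrable_mul_comp_add_smul {a : ℝ} (ha : a ≠ 0) {m G : V → ℝ} (hm : Integrable m)
    (hG : Integrable G) (hGc : Continuous G) :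
    Integrable (fun p : V × V => m p.2 * G (p.2 + a • p.1)) (volume.prod volume) := by
  have hmeas : AEStronglyMeasurable (fun p : V × V => m p.2 * G (p.2 + a • p.1))
      (volume.prod volume) :=
    hm.aestronglyMeasurable.comp_snd.mul (hGc.comp (by fun_prop)).aestronglyMeasurable
  rw [integrable_prod_iff' hmeas]
  refine ⟨ae_of_all _ fun w => ((hG.comp_add_left w).comp_smul ha).const_mul (m w), ?_⟩
  have : ∀ w, ∫ x, ‖m w * G (w + a • x)‖
      = ‖m w‖ * (|(a ^ Module.finrank ℝ V)⁻¹| * ∫ x, ‖G x‖) := fun w => by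
    simp only [norm_mul]
    rw [integral_const_mul, Measure.integral_comp_smul volume (fun x => ‖G (w + x)‖) a,
      integral_add_left_eq_self (fun x => ‖G x‖) w, smul_eq_mul]
  simp only [this]
  exact hm.norm.mul_const _

/-- Convergence of regularized Fresnel integrals and the bound for their limit. -/
theorem exists_tendsto_fresnel {a : ℝ} (ha : 0 < a) (f : V →ᵇ ℂ) (h Γ : 𝓢(V, ℂ)) (M : V → ℝ≥0∞)
    (hMm : Measurable M) (hM : ∫⁻ w, M w < ⊤)
    (hfM : ∀ x w, ‖𝓕 (fun y => f y * h (y - x)) w‖ₑ ≤ M w) :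
    ∃ L : ℂ, (∀ φ : 𝓢(V, ℂ), φ 0 = 1 → Tendsto (fun ε : ℝ =>
        (∫ u : V, chirp (-a) u * (Γ u * h u)) * ∫ y : V, chirp a y * f y * φ (ε • y))
          (𝓝[>] 0) (𝓝 L)) ∧
      ‖L‖ₑ ≤ ENNReal.ofReal (a ^ Module.finrank ℝ V)⁻¹ *
        (∫⁻ v, ‖(𝓕⁻ Γ : 𝓢(V, ℂ)) v‖ₑ) * ∫⁻ w, M w := by
  set U : V → V → ℂ := fun x => 𝓕 fun y => f y * h (y - x) with hU
  have hUc : ∀ x, Continuous (U x) := fun x => continuous_fourier_of_integrable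
    (((h.integrable (μ := volume)).comp_sub_right x).bdd_mul f.continuous.aestronglyMeasurable
        (ae_of_all _ f.norm_coe_le_norm))
  have hUi : ∀ x, Integrable (U x) := fun x => integrable_of_enorm_le (hUc x) hM (hfM x)
  -- M may be infinite on a null set, so the real majorant bounds the transform only almost
  -- everywhere.
  set m : V → ℝ := fun w => (M w).toReal
  have hm : Integrable m := integrable_toReal_of_lintegral_ne_top hMm.aemeasurable hM.ne
  have hfin : ∀ᵐ w, M w < ⊤ := ae_lt_top hMm hM.ne
  have hUm : ∀ x, ∀ᵐ w, ‖U x w‖ ≤ m w := fun x => by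
    filter_upwards [hfin] with w hw
    have := ENNReal.toReal_mono hw.ne (hfM x w)
    simpa using this
  -- This expression does not involve φ, so the limit is the same for every cutoff.
  set L : ℂ := ∫ x : V, chirp (-a) x *
    ∫ w, U x w * (planeWave (w + a • x) x * (𝓕⁻ Γ : 𝓢(V, ℂ)) (w + a • x)) with hL
  refine ⟨L, fun φ hφ => ?_, ?_⟩
  -- Decay of order dim V + 1 is integrable.
  · set r := Module.finrank ℝ V + 1
    obtain ⟨C, hC, hK⟩ := exists_norm_cutoffFourier_le Γ φ r
    set G : V → ℝ := fun v => C * (1 + ‖v‖) ^ (-(r : ℝ)) with hG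
    have hGi : Integrable G :=
      (integrable_one_add_norm (by simp only [r]; push_cast; linarith)).const_mul C
    have hGc : Continuous G := continuous_const.mul
      ((by fun_prop : Continuous fun v : V => 1 + ‖v‖).rpow_const fun v => Or.inl (by positivity))
    have hGC : ∀ v, ‖G v‖ ≤ C := fun v => by
      rw [Real.norm_of_nonneg (by positivity)]
      exact mul_le_of_le_one_right hC
        (Real.rpow_le_one_of_one_le_of_nonpos (by simp) (by simp))
    have hprod := integrable_mul_comp_add_smul ha.ne' hm hGi hGc
    have hinner : ∀ x, Integrable fun w => m w * G (w + a • x) := fun x =>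
      hm.mul_bdd (hGc.comp (by fun_prop)).aestronglyMeasurable (ae_of_all _ fun w => hGC _)
    have hev : ∀ᶠ ε : ℝ in 𝓝[>] 0, 0 < ε ∧ |ε| ≤ 1 := by
      filter_upwards [Ioo_mem_nhdsGT one_pos] with ε hε
      exact ⟨hε.1, by rw [abs_of_pos hε.1]; exact hε.2.le⟩
    have hbound : ∀ ε : ℝ, |ε| ≤ 1 → ∀ x, ∀ᵐ w,
        ‖U x w * cutoffFourier Γ φ ε x (w + a • x)‖ ≤ m w * G (w + a • x) := by
      intro ε hε x
      filter_upwards [hUm x] with w hw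
      rw [norm_mul]
      exact mul_le_mul hw (hK ε hε _ _) (norm_nonneg _) ENNReal.toReal_nonneg
    have hcongr : (fun ε : ℝ => (∫ u : V, chirp (-a) u * (Γ u * h u)) *
        ∫ y : V, chirp a y * f y * φ (ε • y)) =ᶠ[𝓝[>] 0] fun ε => ∫ x : V, chirp (-a) x *
          ∫ w, U x w * cutoffFourier Γ φ ε x (w + a • x) := by
      filter_upwards [hev] with ε hε
      exact (fresnel_regularized_eq hε.1.ne' f h Γ φ hUi).2
    refine Tendsto.congr' hcongr.symm ?_
    refine tendsto_integral_filter_of_dominated_convergence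
      (fun x => ∫ w, m w * G (w + a • x)) ?_ ?_ hprod.integral_prod_left
      (ae_of_all _ fun x => ?_)
    · filter_upwards [hev] with ε hε
      exact (fresnel_regularized_eq hε.1.ne' f h Γ φ hUi).1.aestronglyMeasurable
    · filter_upwards [hev] with ε hε
      refine ae_of_all _ fun x => ?_
      rw [norm_mul, norm_chirp, one_mul]
      exact norm_integral_le_of_norm_le (hinner x) (hbound ε hε.2 x)
    · refine Tendsto.const_mul _ ?_
      refine tendsto_integral_filter_of_dominated_convergence (fun w => m w * G (w + a • x))
        (Eventually.of_forall fun ε => ((hUc x).mul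
          ((continuous_cutoffFourier Γ φ ε x).comp (by fun_prop))).aestronglyMeasurable) ?_
        (hinner x) (ae_of_all _ fun w => ?_)
      · filter_upwards [hev] with ε hε
        exact hbound ε hε.2 x
      · exact ((tendsto_cutoffFourier Γ φ hφ x (w + a • x)).mono_left
          nhdsWithin_le_nhds).const_mul _
  · set γ : V → ℝ≥0∞ := fun v => ‖(𝓕⁻ Γ : 𝓢(V, ℂ)) v‖ₑ with hγ
    have hγm : Measurable γ := (𝓕⁻ Γ : 𝓢(V, ℂ)).continuous.measurable.enorm
    calc ‖L‖ₑ ≤ ∫⁻ x, ∫⁻ w, M w * γ (w + a • x) := by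
          refine (enorm_integral_le_lintegral_enorm _).trans (lintegral_mono fun x => ?_)
          have hc : ‖chirp (-a) x‖ₑ = 1 := by simp [enorm_eq_nnnorm, nnnorm, norm_chirp]
          rw [enorm_mul, hc, one_mul]
          refine (enorm_integral_le_lintegral_enorm _).trans (lintegral_mono fun w => ?_)
          have hp : ‖planeWave (w + a • x) x‖ₑ = 1 := by
            simp [enorm_eq_nnnorm, nnnorm, norm_planeWave]
          rw [enorm_mul, enorm_mul, hp, one_mul]
          exact mul_le_mul_left (hfM x w) _
      _ = ∫⁻ w, ∫⁻ x, M w * γ (w + a • x) := by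
          refine lintegral_lintegral_swap (Measurable.aemeasurable ?_)
          exact (hMm.comp measurable_snd).mul (hγm.comp (by fun_prop))
      _ = ∫⁻ w, M w * (ENNReal.ofReal (a ^ Module.finrank ℝ V)⁻¹ * ∫⁻ v, γ v) := by
          refine lintegral_congr fun w => ?_
          have hγw : Measurable fun x => γ (w + a • x) := hγm.comp (by fun_prop)
          rw [lintegral_const_mul _ hγw,
            lintegral_comp_smul (F := fun v => γ (w + v)) (hγm.comp (by fun_prop)) ha.ne',
            lintegral_add_left_eq_self γ w, abs_of_nonneg (by positivity)]
      _ = _ := by rw [lintegral_mul_const _ hMm, mul_comm]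

end Oscillatory

/-! ### The Fresnel functional on the Sjöstrand class -/

section Sjostrand

variable {d : ℕ}

/-- A tempered distribution as a continuous linear functional. -/
def functional (T : 𝓢'(EuclideanSpace ℝ (Fin d), ℂ)) : 𝓢(EuclideanSpace ℝ (Fin d), ℂ) →L[ℂ] ℂ where
  toFun := T
  map_add' := map_add T
  map_smul' := map_smul T
  cont := map_continuous T

/-- The supremum over all positions of the short-time Fourier transform at frequency `w`, in the
normalization of the Fourier transform `𝓕`. -/
def frequencyEnvelope (T : 𝓢'(EuclideanSpace ℝ (Fin d), ℂ))
    (h : 𝓢(EuclideanSpace ℝ (Fin d), ℂ)) (w : EuclideanSpace ℝ (Fin d)) : ℝ≥0∞ :=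
  ⨆ x, ‖T (modulate (-w) (SchwartzMap.compSubConstCLM ℂ x h))‖ₑ

theorem measurable_frequencyEnvelope (T : 𝓢'(EuclideanSpace ℝ (Fin d), ℂ))
    (h : 𝓢(EuclideanSpace ℝ (Fin d), ℂ)) : Measurable (frequencyEnvelope T h) := by
  refine (lowerSemicontinuous_iSup fun x => Continuous.lowerSemicontinuous ?_).measurable
  exact (((functional T).continuous.comp
    ((continuous_modulate _).comp continuous_neg))).enorm

/-- The frequency variables are related by ξ = 2πħ w; conjugating the phase shift replaces g by its
conjugate. -/
theorem stft_eq (ħ : ℝ) (g : 𝓢(EuclideanSpace ℝ (Fin d), ℂ))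
    (T : 𝓢'(EuclideanSpace ℝ (Fin d), ℂ)) (x ξ : EuclideanSpace ℝ (Fin d)) :
    stft ħ g T x ξ = (((2 * Real.pi * ħ) ^ (-(d : ℝ) / 2) : ℝ) : ℂ) *
      T (modulate (-((2 * Real.pi * ħ)⁻¹ • ξ))
        (SchwartzMap.compSubConstCLM ℂ x (conjSchwartz g))) := by
  rw [stft, ← smul_eq_mul, ← map_smul]
  congr 1
  ext y
  rw [conjSchwartz_apply, phaseShift_apply, smul_apply, modulate_apply,
    SchwartzMap.compSubConstCLM_apply, conjSchwartz_apply, map_mul, map_mul, Complex.conj_ofReal,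
    smul_eq_mul, mul_assoc, ← Complex.exp_conj, planeWave]
  congr 3
  simp only [map_mul, map_div₀, Complex.conj_I, Complex.conj_ofReal, inner_neg_left,
    real_inner_smul_left]
  push_cast
  have := Complex.ofReal_ne_zero.2 Real.pi_ne_zero
  field_simp

theorem sjostrandNorm_eq {ħ : ℝ} (hħ : 0 < ħ) (g : 𝓢(EuclideanSpace ℝ (Fin d), ℂ))
    (T : 𝓢'(EuclideanSpace ℝ (Fin d), ℂ)) :
    sjostrandNorm ħ g T = ENNReal.ofReal ((2 * Real.pi * ħ) ^ (-(d : ℝ) / 2)) *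
      (ENNReal.ofReal ((2 * Real.pi * ħ)⁻¹ ^ d)⁻¹ *
        ∫⁻ w, frequencyEnvelope T (conjSchwartz g) w) := by
  have hpos : 0 < 2 * Real.pi * ħ := by positivity
  have h1 : ∀ ξ, ⨆ x, ‖stft ħ g T x ξ‖ₑ = ENNReal.ofReal ((2 * Real.pi * ħ) ^ (-(d : ℝ) / 2)) *
      frequencyEnvelope T (conjSchwartz g) ((2 * Real.pi * ħ)⁻¹ • ξ) := fun ξ => by
    rw [frequencyEnvelope, ENNReal.mul_iSup]
    refine iSup_congr fun x => ?_
    rw [stft_eq, enorm_mul]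
    congr 1
    rw [← ofReal_norm, Complex.norm_real, Real.norm_of_nonneg (by positivity)]
  have hm := measurable_frequencyEnvelope T (conjSchwartz g)
  have hm' : Measurable fun ξ : EuclideanSpace ℝ (Fin d) =>
      frequencyEnvelope T (conjSchwartz g) ((2 * Real.pi * ħ)⁻¹ • ξ) :=
    hm.comp (measurable_const_smul _)
  rw [sjostrandNorm, lintegral_congr h1, lintegral_const_mul _ hm',
    lintegral_comp_smul hm (inv_pos.2 hpos).ne', finrank_euclideanSpace_fin,
    abs_of_nonneg (by positivity)]

theorem lintegral_frequencyEnvelope_lt_top {ħ : ℝ} (hħ : 0 < ħ)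
    {g : 𝓢(EuclideanSpace ℝ (Fin d), ℂ)} {T : 𝓢'(EuclideanSpace ℝ (Fin d), ℂ)}
    (h : sjostrandNorm ħ g T < ⊤) : ∫⁻ w, frequencyEnvelope T (conjSchwartz g) w < ⊤ := by
  have hpos : 0 < 2 * Real.pi * ħ := by positivity
  by_contra hcon
  rw [not_lt_top_iff] at hcon
  rw [sjostrandNorm_eq hħ, hcon, ENNReal.mul_top, ENNReal.mul_top] at h
  · exact lt_irrefl _ h
  · exact (ENNReal.ofReal_pos.2 (by positivity)).ne'
  · exact (ENNReal.ofReal_pos.2 (by positivity)).ne'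

theorem integral_mul_conjSchwartz_ne_zero {g : 𝓢(EuclideanSpace ℝ (Fin d), ℂ)} (hg : g ≠ 0) :
    ∫ y, g y * conjSchwartz g y ≠ 0 := by
  obtain ⟨y₀, hy₀⟩ : ∃ y, g y ≠ 0 := by
    by_contra hcon
    push Not at hcon
    exact hg (by ext y; simp [hcon])
  have h1 : ∀ y, g y * conjSchwartz g y = ((‖g y‖ ^ 2 : ℝ) : ℂ) := fun y => by
    rw [conjSchwartz_apply, Complex.mul_conj, Complex.normSq_eq_norm_sq]
  have hint : Integrable fun y => ‖g y‖ ^ 2 := by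
    refine ((mulSchwartz g (conjSchwartz g)).integrable (μ := volume)).norm.congr
      (ae_of_all _ fun y => ?_)
    simp only [mulSchwartz_apply, h1, Complex.norm_real]
    exact Real.norm_of_nonneg (by positivity)
  simp only [h1]
  rw [integral_complex_ofReal, Complex.ofReal_ne_zero]
  exact (integral_pos_of_integrable_nonneg_nonzero (g.continuous.norm.pow 2) hint
    (fun y => sq_nonneg ‖g y‖) (x := y₀) (pow_ne_zero 2 (norm_ne_zero_iff.2 hy₀))).ne'

theorem exists_isRepresentedBy {ħ : ℝ} (hħ : 0 < ħ) {T : 𝓢'(EuclideanSpace ℝ (Fin d), ℂ)}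
    (hT : T ∈ sjostrandClass ħ d) : ∃ f : EuclideanSpace ℝ (Fin d) →ᵇ ℂ, IsRepresentedBy T f := by
  obtain ⟨g, hg, hlt⟩ := hT
  exact exists_boundedContinuous_representation (functional T) (conjSchwartz g) g
    (integral_mul_conjSchwartz_ne_zero hg) _ (lintegral_frequencyEnvelope_lt_top hħ hlt)
    fun x w => le_iSup (fun x => ‖T (modulate (-w)
      (SchwartzMap.compSubConstCLM ℂ x (conjSchwartz g)))‖ₑ) x

theorem isRepresentedBy_representative {ħ : ℝ} (hħ : 0 < ħ)
    {T : 𝓢'(EuclideanSpace ℝ (Fin d), ℂ)} (hT : T ∈ sjostrandClass ħ d) :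
    IsRepresentedBy T (representative T) := by
  have h := exists_isRepresentedBy hħ hT
  rw [representative, dif_pos h]
  exact h.choose_spec

theorem exp_eq_chirp (ħ : ℝ) (x : EuclideanSpace ℝ (Fin d)) :
    Complex.exp (Complex.I / (2 * (ħ : ℂ)) * ((‖x‖ ^ 2 : ℝ) : ℂ))
      = chirp (2 * Real.pi * ħ)⁻¹ x := by
  rw [chirp]
  congr 1
  have := Complex.ofReal_ne_zero.2 Real.pi_ne_zero
  push_cast
  field_simp

theorem norm_two_pi_I_mul_cpow {ħ : ℝ} (hħ : 0 < ħ) :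
    ‖(2 * (Real.pi : ℂ) * Complex.I * (ħ : ℂ)) ^ (-(d : ℂ) / 2)‖
      = (2 * Real.pi * ħ) ^ (-(d : ℝ) / 2) := by
  have h1 : (-(d : ℂ) / 2) = ((-(d : ℝ) / 2 : ℝ) : ℂ) := by push_cast; ring
  rw [h1, Complex.norm_cpow_real]
  congr 1
  simp [abs_of_pos Real.pi_pos, abs_of_pos hħ]

/-- Fresnel integrability, with an estimate of the Fresnel integral by the norm of the Sjöstrand
class. -/
theorem exists_hasFresnelIntegral {ħ : ℝ} (hħ : 0 < ħ) {g : 𝓢(EuclideanSpace ℝ (Fin d), ℂ)}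
    {T : 𝓢'(EuclideanSpace ℝ (Fin d), ℂ)} (hlt : sjostrandNorm ħ g T < ⊤)
    {f : EuclideanSpace ℝ (Fin d) →ᵇ ℂ} (hf : IsRepresentedBy T f)
    {Γ : 𝓢(EuclideanSpace ℝ (Fin d), ℂ)}
    (hκ : ∫ u, chirp (-(2 * Real.pi * ħ)⁻¹) u * (Γ u * conjSchwartz g u) ≠ 0) :
    ∃ c : ℂ, HasFresnelIntegral ħ f c ∧
      ‖∫ u, chirp (-(2 * Real.pi * ħ)⁻¹) u * (Γ u * conjSchwartz g u)‖ₑ * ‖c‖ₑ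
        ≤ (∫⁻ v, ‖(𝓕⁻ Γ : 𝓢(EuclideanSpace ℝ (Fin d), ℂ)) v‖ₑ) * sjostrandNorm ħ g T := by
  have hpos : 0 < 2 * Real.pi * ħ := by positivity
  set a := (2 * Real.pi * ħ)⁻¹ with ha
  set κ := ∫ u, chirp (-a) u * (Γ u * conjSchwartz g u)
  obtain ⟨L, hL, hLn⟩ := exists_tendsto_fresnel (inv_pos.2 hpos) f (conjSchwartz g) Γ
    (frequencyEnvelope T (conjSchwartz g)) (measurable_frequencyEnvelope _ _)
    (lintegral_frequencyEnvelope_lt_top hħ hlt) (fun x w => by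
      have : 𝓕 (fun y => f y * conjSchwartz g (y - x)) w
          = T (modulate (-w) (SchwartzMap.compSubConstCLM ℂ x (conjSchwartz g))) := by
        rw [hf, fourier_eq_planeWave]
        refine integral_congr_ae (ae_of_all _ fun y => ?_)
        simp only [modulate_apply, SchwartzMap.compSubConstCLM_apply]
        ring
      rw [this]
      exact le_iSup (fun x => ‖T (modulate (-w)
        (SchwartzMap.compSubConstCLM ℂ x (conjSchwartz g)))‖ₑ) x)
  set p := (2 * (Real.pi : ℂ) * Complex.I * (ħ : ℂ)) ^ (-(d : ℂ) / 2) with hp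
  refine ⟨p * (κ⁻¹ * L), fun φ hφ => ⟨fun ε hε => ?_, ?_⟩, ?_⟩
  · simp only [exp_eq_chirp]
    refine integrable_comp_cutoff hε.ne' ((continuous_chirp _).mul f.continuous) (B := ‖f‖)
      fun y => ?_
    simpa using f.norm_coe_le_norm y
  · simp only [exp_eq_chirp]
    refine (((hL φ hφ).const_mul κ⁻¹).const_mul p).congr fun ε => ?_
    rw [inv_mul_cancel_left₀ hκ]
  · have hpn : ‖p‖ₑ = ENNReal.ofReal ((2 * Real.pi * ħ) ^ (-(d : ℝ) / 2)) := by
      rw [← ofReal_norm, norm_two_pi_I_mul_cpow hħ]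
    have h1 : ‖κ‖ₑ * ‖p * (κ⁻¹ * L)‖ₑ = ‖p‖ₑ * ‖L‖ₑ := by
      rw [← enorm_mul, ← enorm_mul]
      congr 1
      field_simp
    -- |p| = (2πħ)^{-d/2} and the Jacobian a^{-d} are exactly the two factors in `sjostrandNorm_eq`,
    -- so no constant survives.
    rw [finrank_euclideanSpace_fin] at hLn
    rw [h1, hpn, sjostrandNorm_eq hħ]
    calc _ ≤ _ := mul_le_mul_right hLn _
      _ = _ := by ring

/-- The complex-valued Gaussian `exp(-∑ b_j x_j²)`. -/
def complexGaussian {n : ℕ} (b : Fin n → ℝ) (hb : ∀ j, 0 < b j) :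
    𝓢(EuclideanSpace ℝ (Fin n), ℂ) :=
  SchwartzMap.postcompCLM (𝕜 := ℝ) Complex.ofRealCLM (realGaussian b hb)

theorem complexGaussian_apply {n : ℕ} (b : Fin n → ℝ) (hb : ∀ j, 0 < b j)
    (x : EuclideanSpace ℝ (Fin n)) :
    complexGaussian b hb x = Complex.exp (-∑ j, (b j : ℂ) * (x j : ℂ) ^ 2) := by
  have : complexGaussian b hb x = ((Real.exp (-∑ j, b j * x j ^ 2) : ℝ) : ℂ) := rfl
  rw [this]
  push_cast
  rfl

theorem HasFresnelIntegral.unique {ħ : ℝ} {f : EuclideanSpace ℝ (Fin d) → ℂ} {c c' : ℂ}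
    (h : HasFresnelIntegral ħ f c) (h' : HasFresnelIntegral ħ f c') : c = c' := by
  have h0 : complexGaussian (fun _ : Fin d => (1 : ℝ)) (fun _ => one_pos) 0 = 1 := by
    simp [complexGaussian_apply]
  exact tendsto_nhds_unique (h _ h0).2 (h' _ h0).2

theorem hasFresnelIntegral_fresnelIntegral {ħ : ℝ} {f : EuclideanSpace ℝ (Fin d) → ℂ} {c : ℂ}
    (h : HasFresnelIntegral ħ f c) : HasFresnelIntegral ħ f (fresnelIntegral ħ f) := by
  have hex : ∃ c, HasFresnelIntegral ħ f c := ⟨c, h⟩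
  rw [fresnelIntegral, dif_pos hex]
  exact hex.choose_spec

theorem hasTemperateGrowth_chirp (a : ℝ) :
    (chirp a : EuclideanSpace ℝ (Fin d) → ℂ).HasTemperateGrowth := by
  have h1 : (fun y : EuclideanSpace ℝ (Fin d) => Real.pi * a * ‖y‖ ^ 2).HasTemperateGrowth :=
    (Function.HasTemperateGrowth.const (Real.pi * a)).mul
      (Function.hasTemperateGrowth_norm_sq (EuclideanSpace ℝ (Fin d)))
  have he : (chirp a : EuclideanSpace ℝ (Fin d) → ℂ)
      = (fun t : ℝ => Complex.exp (Complex.I * (t : ℂ))) ∘ fun y => Real.pi * a * ‖y‖ ^ 2 := by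
    funext y
    simp only [chirp, Function.comp_apply, mul_comm Complex.I]
  rw [he]
  exact hasTemperateGrowth_cexp_mul_I.comp h1

theorem hasFresnelIntegral_fresnelFunctional {ħ : ℝ} (hħ : 0 < ħ)
    {T : 𝓢'(EuclideanSpace ℝ (Fin d), ℂ)} (hT : T ∈ sjostrandClass ħ d) :
    HasFresnelIntegral ħ (representative T) (fresnelFunctional ħ T) := by
  have hrep := isRepresentedBy_representative hħ hT
  obtain ⟨g, hg, hlt⟩ := hT
  -- For an arbitrary window this choice cancels the chirp in κ, leaving ∫ |g|² ≠ 0.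
  set Γ := SchwartzMap.smulLeftCLM ℂ (chirp (2 * Real.pi * ħ)⁻¹) g
  have hκ : ∫ u, chirp (-(2 * Real.pi * ħ)⁻¹) u * (Γ u * conjSchwartz g u) ≠ 0 := by
    have : ∀ u : EuclideanSpace ℝ (Fin d), chirp (-(2 * Real.pi * ħ)⁻¹) u *
        (Γ u * conjSchwartz g u) = g u * conjSchwartz g u := fun u => by
      have h1 : chirp (-(2 * Real.pi * ħ)⁻¹) u * chirp (2 * Real.pi * ħ)⁻¹ u = 1 := by
        rw [chirp, chirp, ← Complex.exp_add]
        simp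
      rw [SchwartzMap.smulLeftCLM_apply_apply (hasTemperateGrowth_chirp _), smul_eq_mul,
        ← mul_assoc, ← mul_assoc, h1, one_mul]
    simp only [this]
    exact integral_mul_conjSchwartz_ne_zero hg
  obtain ⟨c, hc, -⟩ := exists_hasFresnelIntegral hħ hlt hrep hκ
  exact hasFresnelIntegral_fresnelIntegral hc

end Sjostrand

/-! ### Gaussian windows -/

section Gaussian

variable {n : ℕ}

theorem integral_cexp_neg_sum_sq_add_euclideanSpace {b : Fin n → ℂ} (hb : ∀ i, 0 < (b i).re)
    (c : Fin n → ℂ) :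
    ∫ v : EuclideanSpace ℝ (Fin n), Complex.exp (-∑ i, b i * (v i : ℂ) ^ 2 + ∑ i, c i * v i)
      = ∏ i, (Real.pi / b i) ^ (1 / 2 : ℂ) * Complex.exp (c i ^ 2 / (4 * b i)) := by
  rw [← GaussianFourier.integral_cexp_neg_sum_mul_add hb c,
    ← (PiLp.volume_preserving_toLp (Fin n)).integral_comp
      (MeasurableEquiv.toLp 2 _).measurableEmbedding]

theorem fourierInv_complexGaussian (b : Fin n → ℝ) (hb : ∀ j, 0 < b j)
    (w : EuclideanSpace ℝ (Fin n)) :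
    (𝓕⁻ (complexGaussian b hb) : 𝓢(EuclideanSpace ℝ (Fin n), ℂ)) w
      = ((∏ j, (Real.pi / b j) ^ (1 / 2 : ℝ) *
          Real.exp (-(Real.pi * w j) ^ 2 / b j) : ℝ) : ℂ) := by
  rw [fourierInv_schwartz_apply]
  have h1 : ∀ v : EuclideanSpace ℝ (Fin n), planeWave w v * complexGaussian b hb v
      = Complex.exp (-∑ i, (b i : ℂ) * (v i : ℂ) ^ 2
        + ∑ i, (2 * Real.pi * Complex.I * w i) * v i) := fun v => by
    rw [complexGaussian_apply, planeWave, ← Complex.exp_add, add_comm]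
    congr 2
    rw [PiLp.inner_apply]
    push_cast
    rw [Finset.mul_sum, Finset.sum_mul]
    refine Finset.sum_congr rfl fun i _ => ?_
    simp only [RCLike.inner_apply, conj_trivial]
    push_cast
    ring
  simp only [h1]
  rw [integral_cexp_neg_sum_sq_add_euclideanSpace (fun i => by simpa using hb i)]
  push_cast
  refine Finset.prod_congr rfl fun j _ => ?_
  congr 1
  · rw [Complex.ofReal_cpow (div_pos Real.pi_pos (hb j)).le]
    push_cast
    rfl
  · congr 1
    have := Complex.ofReal_ne_zero.2 (hb j).ne'
    have hI := Complex.I_sq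
    field_simp
    linear_combination (4 * (w j : ℂ) ^ 2) * hI

/-- The transform is nonnegative, so its L¹ norm is its integral, which by Fourier inversion is the
value of the Gaussian at 0. -/
theorem lintegral_enorm_fourierInv_complexGaussian (b : Fin n → ℝ) (hb : ∀ j, 0 < b j) :
    ∫⁻ v, ‖(𝓕⁻ (complexGaussian b hb) : 𝓢(EuclideanSpace ℝ (Fin n), ℂ)) v‖ₑ = 1 := by
  set F : 𝓢(EuclideanSpace ℝ (Fin n), ℂ) := 𝓕⁻ (complexGaussian b hb) with hF
  have hnorm : ∀ v, ((‖F v‖ : ℝ) : ℂ) = F v := fun v => by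
    rw [hF, fourierInv_complexGaussian, Complex.norm_real, Real.norm_of_nonneg]
    exact Finset.prod_nonneg fun j _ => mul_nonneg
      (Real.rpow_nonneg (div_pos Real.pi_pos (hb j)).le _) (Real.exp_nonneg _)
  have h0 : ∫ v, F v = 1 := by
    have h1 : (𝓕 F : 𝓢(EuclideanSpace ℝ (Fin n), ℂ)) 0 = ∫ v, F v := by
      rw [fourier_schwartz_apply]
      simp
    rw [← h1, hF, FourierTransform.fourier_fourierInv_eq, complexGaussian_apply]
    simp
  have h2 : ∫ v, ‖F v‖ = 1 := by
    have : ((∫ v, ‖F v‖ : ℝ) : ℂ) = 1 := by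
      rw [← integral_complex_ofReal]
      simp only [hnorm, h0]
    exact_mod_cast this
  rw [← ofReal_integral_norm_eq_lintegral_enorm F.integrable, h2, ENNReal.ofReal_one]

/-- The right-hand side is |2q + i|^{-1/2} = (1 + 4q²)^{-1/4}, and log(1 + 4q²) ≤ 4q². -/
theorem exp_neg_sq_le_norm_cpow {ħ q : ℝ} (hħ : 0 < ħ) (hq : 0 < q) :
    Real.exp (-q ^ 2) ≤ (2 * Real.pi * ħ) ^ (-1 / 2 : ℝ) *
      ‖((Real.pi : ℂ) / ((2 * q + Complex.I) / (2 * ħ))) ^ (1 / 2 : ℂ)‖ := by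
  have hpos : 0 < 2 * Real.pi * ħ := by positivity
  have hz : ‖(2 * q + Complex.I : ℂ)‖ ^ 2 = 4 * q ^ 2 + 1 := by
    rw [← Complex.normSq_eq_norm_sq, Complex.normSq_apply]
    simp
    ring
  set r := ‖(2 * q + Complex.I : ℂ)‖ with hr
  have hr0 : 0 < r := by
    by_contra hcon
    have : r = 0 := le_antisymm (not_lt.1 hcon) (norm_nonneg _)
    rw [this] at hz
    nlinarith
  have h1 : (1 / 2 : ℂ) = ((1 / 2 : ℝ) : ℂ) := by push_cast; rfl
  have h2 : ‖(Real.pi : ℂ) / ((2 * q + Complex.I) / (2 * ħ))‖ = 2 * Real.pi * ħ / r := by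
    rw [norm_div, norm_div, ← hr]
    simp only [norm_mul, Complex.norm_real, Complex.norm_two, Real.norm_of_nonneg Real.pi_pos.le,
      Real.norm_of_nonneg hħ.le]
    field_simp
  rw [h1, Complex.norm_cpow_real, h2, Real.div_rpow hpos.le hr0.le, mul_div_assoc',
    ← Real.rpow_add hpos]
  norm_num
  rw [← Real.rpow_neg hr0.le, Real.rpow_def_of_pos hr0]
  refine Real.exp_le_exp.2 ?_
  have hlog : Real.log r ≤ 2 * q ^ 2 := by
    have h3 : 2 * Real.log r = Real.log (4 * q ^ 2 + 1) := by
      rw [← hz, Real.log_pow]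
      norm_num
    have h4 := Real.log_le_sub_one_of_pos (show 0 < 4 * q ^ 2 + 1 by positivity)
    linarith
  linarith

theorem exp_neg_sum_sq_le_norm_integral {ħ : ℝ} (hħ : 0 < ħ) {q : ℕ → ℝ} (hq : ∀ j, 0 < q j)
    (n : ℕ) :
    Real.exp (-∑ j : Fin n, q j ^ 2) ≤ ‖∫ u, chirp (-(2 * Real.pi * ħ)⁻¹) u *
      (complexGaussian (fun j : Fin n => q j / (2 * ħ)) (fun j => div_pos (hq j) (by positivity)) u
        * conjSchwartz (gaussianWindow ħ hħ q hq n) u)‖ := by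
  have hpos : 0 < 2 * Real.pi * ħ := by positivity
  -- The window and Γ each contribute q j / (2ħ), the chirp contributes i / (2ħ).
  set b : Fin n → ℂ := fun j => (2 * q j + Complex.I) / (2 * ħ) with hb
  have hbre : ∀ j, 0 < (b j).re := fun j => by
    have : b j = (((2 * q j) / (2 * ħ) : ℝ) : ℂ) + ((1 / (2 * ħ) : ℝ) : ℂ) * Complex.I := by
      simp only [hb]
      push_cast
      ring
    rw [this]
    simp only [Complex.add_re, Complex.ofReal_re, Complex.mul_I_re, Complex.ofReal_im, neg_zero,
      add_zero]
    have := hq j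
    positivity
  have hpt : ∀ u : EuclideanSpace ℝ (Fin n), chirp (-(2 * Real.pi * ħ)⁻¹) u *
      (complexGaussian (fun j : Fin n => q j / (2 * ħ)) (fun j => div_pos (hq j) (by positivity)) u
        * conjSchwartz (gaussianWindow ħ hħ q hq n) u)
      = (((2 * Real.pi * ħ) ^ (-(n : ℝ) / 2) : ℝ) : ℂ) *
        Complex.exp (-∑ i, b i * (u i : ℂ) ^ 2 + ∑ i : Fin n, (0 : ℂ) * u i) := fun u => by
    rw [conjSchwartz_apply, gaussianWindow_apply, Complex.conj_ofReal, Complex.ofReal_mul,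
      Complex.ofReal_exp, complexGaussian_apply, chirp, mul_left_comm (Complex.exp (-_)),
      mul_left_comm (Complex.exp _) (Complex.ofReal _), ← Complex.exp_add, ← Complex.exp_add]
    congr 2
    rw [EuclideanSpace.real_norm_sq_eq]
    push_cast
    simp only [zero_mul, Finset.sum_const_zero, add_zero, Finset.mul_sum, Finset.sum_mul,
      ← Finset.sum_neg_distrib, ← Finset.sum_add_distrib]
    refine Finset.sum_congr rfl fun j _ => ?_
    have h1 := Complex.ofReal_ne_zero.2 Real.pi_ne_zero
    have h2 := Complex.ofReal_ne_zero.2 hħ.ne'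
    simp only [hb]
    field_simp
    ring
  simp only [hpt]
  rw [integral_const_mul, integral_cexp_neg_sum_sq_add_euclideanSpace hbre, norm_mul, norm_prod,
    Complex.norm_real, Real.norm_of_nonneg (by positivity), ← Finset.sum_neg_distrib,
    Real.exp_sum]
  have hc : (2 * Real.pi * ħ) ^ (-(n : ℝ) / 2)
      = ∏ _j : Fin n, (2 * Real.pi * ħ) ^ (-1 / 2 : ℝ) := by
    rw [Finset.prod_const, Finset.card_univ, Fintype.card_fin, ← Real.rpow_mul_natCast hpos.le]
    congr 1
    ring
  rw [hc, ← Finset.prod_mul_distrib]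
  refine Finset.prod_le_prod (fun j _ => (Real.exp_pos _).le) fun j _ => ?_
  have := exp_neg_sq_le_norm_cpow hħ (hq j)
  simpa [hb] using this

theorem fresnelOpNorm_gaussianWindow_le {ħ : ℝ} (hħ : 0 < ħ) {q : ℕ → ℝ} (hq : ∀ j, 0 < q j)
    (n : ℕ) : fresnelOpNorm ħ (gaussianWindow ħ hħ q hq n)
      ≤ ENNReal.ofReal (Real.exp (∑ j : Fin n, q j ^ 2)) := by
  refine iSup₂_le fun T hT => ?_
  rcases eq_or_ne (sjostrandNorm ħ (gaussianWindow ħ hħ q hq n) T) ⊤ with htop | htop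
  -- Division by ⊤ gives 0 in `ℝ≥0∞`, so distributions of infinite norm for this window do not
  -- matter and equivalence of windows is not needed.
  · simp [htop]
  refine ENNReal.div_le_of_le_mul ?_
  set κ := ∫ u, chirp (-(2 * Real.pi * ħ)⁻¹) u *
    (complexGaussian (fun j : Fin n => q j / (2 * ħ)) (fun j => div_pos (hq j) (by positivity)) u
      * conjSchwartz (gaussianWindow ħ hħ q hq n) u) with hκ
  have hle : Real.exp (-∑ j : Fin n, q j ^ 2) ≤ ‖κ‖ := exp_neg_sum_sq_le_norm_integral hħ hq n
  have hκ0 : κ ≠ 0 := norm_pos_iff.1 ((Real.exp_pos _).trans_le hle)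
  obtain ⟨c, hc, hcn⟩ := exists_hasFresnelIntegral hħ (lt_top_iff_ne_top.2 htop)
    (isRepresentedBy_representative hħ hT.1) hκ0
  rw [← hκ, lintegral_enorm_fourierInv_complexGaussian, one_mul] at hcn
  rw [(hasFresnelIntegral_fresnelFunctional hħ hT.1).unique hc]
  have h1 : ENNReal.ofReal (Real.exp (∑ j : Fin n, q j ^ 2)) *
      ENNReal.ofReal (Real.exp (-∑ j : Fin n, q j ^ 2)) = 1 := by
    rw [← ENNReal.ofReal_mul (Real.exp_pos _).le, ← Real.exp_add]
    simp
  calc ‖c‖ₑ = ENNReal.ofReal (Real.exp (∑ j : Fin n, q j ^ 2)) *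
        (ENNReal.ofReal (Real.exp (-∑ j : Fin n, q j ^ 2)) * ‖c‖ₑ) := by
        rw [← mul_assoc, h1, one_mul]
    _ ≤ ENNReal.ofReal (Real.exp (∑ j : Fin n, q j ^ 2)) * (‖κ‖ₑ * ‖c‖ₑ) := by
        gcongr
        rw [← ofReal_norm]
        exact ENNReal.ofReal_le_ofReal hle
    _ ≤ _ := by gcongr

end Gaussian

end Fresnel

end

/-! ### The uniform bound -/

theorem corollary4p2 (ħ : ℝ) (hħ : 0 < ħ) (hħ1 : ħ ≤ 1) (q : ℕ → ℝ) (hq : ∀ j, 0 < q j)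
    (hsum : Summable fun j : ℕ => q j ^ 2) :
    (∀ n : ℕ, ∀ T ∈ Fresnel.sjostrandClass ħ n,
      ∃ f : BoundedContinuousFunction (EuclideanSpace ℝ (Fin n)) ℂ,
        Fresnel.IsRepresentedBy T f ∧
        Fresnel.HasFresnelIntegral ħ f (Fresnel.fresnelFunctional ħ T)) ∧
    (⨆ n : ℕ, Fresnel.fresnelOpNorm ħ (Fresnel.gaussianWindow ħ hħ q hq n)) < ⊤ := by
  refine ⟨fun n T hT => ⟨Fresnel.representative T, Fresnel.isRepresentedBy_representative hħ hT,
    Fresnel.hasFresnelIntegral_fresnelFunctional hħ hT⟩, ?_⟩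
  refine lt_of_le_of_lt (iSup_le fun n => ?_)
    (ENNReal.ofReal_lt_top (r := Real.exp (∑' j, q j ^ 2)))
  refine (Fresnel.fresnelOpNorm_gaussianWindow_le hħ hq n).trans (ENNReal.ofReal_le_ofReal ?_)
  rw [Fin.sum_univ_eq_sum_range (fun j => q j ^ 2)]
  exact Real.exp_le_exp.2 (hsum.sum_le_tsum _ fun j _ => sq_nonneg _)
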